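/- Let $T>0$, let $U\subset\mathbb R^m$ be connected and compact, $\xi\in\mathbb R^n$, and let $f\colon[0,T]\times\mathbb R^n\times\mathbb R^m\to\mathbb R^n$ and $\Psi\colon\mathbb R^n\to\mathbb R$ be Lipschitz continuously differentiable in the following sense: $\Psi$ is differentiable, $f$ is differentiable in $x$ and in $u$ at every point of $[0,T]\times\mathbb R^n\times U$, and there is $L>0$ such that $\Psi$ and $\frac{\partial\Psi}{\partial x}$ are $L$-Lipschitz on $\mathbb R^n$, and $g=f,\frac{\partial f}{\partial x},\frac{\partial f}{\partial u}$ satisfy $\|g(t_1,x_1,u_1)-g(t_2,x_2,u_2)\|\le L(|t_1-t_2|+\|x_1-x_2\|_2+\|u_1-u_2\|_2)$ on $[0,T]\times\mathbb R^n\times U$ (Euclidean norm, respectively induced operator norm). Consider the optimal control problem $$\min\ \Psi(x(T))\quad\text{subject to}\quad x(0)=\xi,\ \ \dot x(t)=f(t,x(t),u(t)),\ \ u(t)\in U\ \text{for a.e. } t\in[0,T],\tag{1}$$ over $x\in L^2([0,T],\mathbb R^n)$ and $u\in L^2([0,T],\mathbb R^m)$; differential equations are understood in the sense of Carathéodory (absolutely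 continuous solutions, equation for a.e. $t$). Let $\mathcal X$ be its set of feasible pairs $(x,u)$. A function $\theta\colon\mathcal X\to(-\infty,0]$ is an *optimality function* of (1) if $\theta(\hat x,\hat u)=0$ for every minimizer $(\hat x,\hat u)$ of (1). For $(x,u_0)\in\mathcal X$ let $$\theta_{o,l}(x,u_0)=\min_{\delta x\in L^2,\ \delta u\in L^2}\ \tfrac{\partial\Psi}{\partial x}(x(T))^{\mathsf T}\delta x(T)$$ subject to $\delta x(0)=0$, $\ \dot{\delta x}(t)=\frac{\partial f}{\partial x}(t,x(t),u_0(t))\,\delta x(t)+\frac{\partial f}{\partial u}(t,x(t),u_0(t))\,\delta u(t)$, and $u_0(t)+\delta u(t)\in U$ for a.e. $t\in[0,T]$. Let $$\theta_{o,h}(x,u_0)=\min_{u\in L^2,\ u(t)\in U\text{ a.e.}}\ \int_0^T H_0(t,x(t),u(t),p_0(t))-H_0(t,x(t),u_0(t),p_0(t))\,dt,$$ where $H_0(t,x,u,p)=p^{\mathsf T}f(t,x,u)$ is the Hamiltonian and the costate $p_0$ is the solution of $p_0(T)=\frac{\partial\Psi}{\partial x}(x(T))$, $\ \dot p_0(t)=-\frac{\partial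 f}{\partial x}(t,x(t),u_0(t))^{\mathsf T}p_0(t)$ on $[0,T]$. Then, for every $(x,u_0)\in\mathcal X$, the costate exists and is unique on $[0,T]$, both minima are attained (so $\theta_{o,l}$ and $\theta_{o,h}$ are well-defined real-valued functions on $\mathcal X$), and $\theta_{o,l}\le 0$. Moreover: 1. if $U$ is convex, then $\theta_{o,l}$ is an optimality function of (1); 2. $\theta_{o,h}$ is an optimality function of (1) (convexity of $U$ is not needed). -/

import Mathlib

open MeasureTheory Set

/-- The data of an optimal control problem with state space `ℝⁿ` and input space `ℝᵐ`
(both with the Euclidean norm): minimize `Ψ (x T)` subject to `x 0 = ξ`,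
`x' t = f t (x t) (u t)` and `u t ∈ U` for almost every `t ∈ [0, T]`. -/
structure ControlProblem (n m : ℕ) where
  /-- The time horizon. -/
  T : ℝ
  /-- The set of admissible input values. -/
  U : Set (EuclideanSpace ℝ (Fin m))
  /-- The initial state. -/
  ξ : EuclideanSpace ℝ (Fin n)
  /-- The vector field. -/
  f : ℝ → EuclideanSpace ℝ (Fin n) → EuclideanSpace ℝ (Fin m) → EuclideanSpace ℝ (Fin n)
  /-- The final cost. -/
  Ψ : EuclideanSpace ℝ (Fin n) → ℝ

/-- Given an optimization problem "minimize `J` over `X`", a real function `θ` is an optimality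
function if it is nonpositive on `X` and vanishes at every minimizer. -/
def IsOptimalityFunction {α : Type*} (X : Set α) (J θ : α → ℝ) : Prop :=
  (∀ z ∈ X, θ z ≤ 0) ∧ ∀ z ∈ X, IsMinOn J X z → θ z = 0

namespace ControlProblem

variable {n m : ℕ} (P : ControlProblem n m)

/-- Lebesgue measure on `[0, T]`. -/
noncomputable def timeMeasure : Measure ℝ := volume.restrict (Icc 0 P.T)

/-- The partial derivative `∂f/∂x (t, x, u)`. -/
noncomputable def fx (t : ℝ) (x : EuclideanSpace ℝ (Fin n)) (u : EuclideanSpace ℝ (Fin m)) :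
    EuclideanSpace ℝ (Fin n) →L[ℝ] EuclideanSpace ℝ (Fin n) :=
  fderiv ℝ (fun y => P.f t y u) x

/-- The partial derivative `∂f/∂u (t, x, u)`. -/
noncomputable def fu (t : ℝ) (x : EuclideanSpace ℝ (Fin n)) (u : EuclideanSpace ℝ (Fin m)) :
    EuclideanSpace ℝ (Fin m) →L[ℝ] EuclideanSpace ℝ (Fin n) :=
  fderiv ℝ (fun v => P.f t x v) u

/-- `f` and `Ψ` are Lipschitz continuously differentiable with constant `L`: `Ψ` is differentiable,
`f` is differentiable in `x` and in `u` at all points of `[0, T] × ℝⁿ × U`, and `Ψ`, `∂Ψ/∂x`, `f`,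
`∂f/∂x`, `∂f/∂u` are Lipschitz there. -/
structure LipschitzC1With (L : ℝ) : Prop where
  diff_Ψ : ∀ x, DifferentiableAt ℝ P.Ψ x
  diff_x : ∀ t ∈ Icc 0 P.T, ∀ x, ∀ u ∈ P.U, DifferentiableAt ℝ (fun y => P.f t y u) x
  diff_u : ∀ t ∈ Icc 0 P.T, ∀ x, ∀ u ∈ P.U, DifferentiableAt ℝ (fun v => P.f t x v) u
  lip_Ψ : ∀ x₁ x₂, |P.Ψ x₁ - P.Ψ x₂| ≤ L * ‖x₁ - x₂‖
  lip_grad : ∀ x₁ x₂, ‖gradient P.Ψ x₁ - gradient P.Ψ x₂‖ ≤ L * ‖x₁ - x₂‖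
  lip_f : ∀ t₁ ∈ Icc 0 P.T, ∀ t₂ ∈ Icc 0 P.T, ∀ x₁ x₂, ∀ u₁ ∈ P.U, ∀ u₂ ∈ P.U,
    ‖P.f t₁ x₁ u₁ - P.f t₂ x₂ u₂‖ ≤ L * (|t₁ - t₂| + ‖x₁ - x₂‖ + ‖u₁ - u₂‖)
  lip_fx : ∀ t₁ ∈ Icc 0 P.T, ∀ t₂ ∈ Icc 0 P.T, ∀ x₁ x₂, ∀ u₁ ∈ P.U, ∀ u₂ ∈ P.U,
    ‖P.fx t₁ x₁ u₁ - P.fx t₂ x₂ u₂‖ ≤ L * (|t₁ - t₂| + ‖x₁ - x₂‖ + ‖u₁ - u₂‖)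
  lip_fu : ∀ t₁ ∈ Icc 0 P.T, ∀ t₂ ∈ Icc 0 P.T, ∀ x₁ x₂, ∀ u₁ ∈ P.U, ∀ u₂ ∈ P.U,
    ‖P.fu t₁ x₁ u₁ - P.fu t₂ x₂ u₂‖ ≤ L * (|t₁ - t₂| + ‖x₁ - x₂‖ + ‖u₁ - u₂‖)

/-- `y` is a (Carathéodory) solution on `[0, T]` of `y' = g`, `y 0 = a`: it is the absolutely
continuous function with initial value `a` and with derivative `g t` at almost every `t`. -/
def SolvesFrom (y g : ℝ → EuclideanSpace ℝ (Fin n)) (a : EuclideanSpace ℝ (Fin n)) : Prop :=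
  Integrable g P.timeMeasure ∧ ∀ t ∈ Icc 0 P.T, y t = a + ∫ s in (0 : ℝ)..t, g s

/-- `u` is an admissible input: square integrable on `[0, T]` with values in `U` almost
everywhere. -/
def IsInput (u : ℝ → EuclideanSpace ℝ (Fin m)) : Prop :=
  MemLp u 2 P.timeMeasure ∧ ∀ᵐ t ∂P.timeMeasure, u t ∈ P.U

/-- The feasible set of the problem: the pairs `(x, u)` of an admissible input and its
trajectory. -/
def feasible : Set ((ℝ → EuclideanSpace ℝ (Fin n)) × (ℝ → EuclideanSpace ℝ (Fin m))) :=
  {z | MemLp z.1 2 P.timeMeasure ∧ P.IsInput z.2 ∧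
    P.SolvesFrom z.1 (fun t => P.f t (z.1 t) (z.2 t)) P.ξ}

/-- The objective of the problem, `Ψ (x T)`. -/
def cost (z : (ℝ → EuclideanSpace ℝ (Fin n)) × (ℝ → EuclideanSpace ℝ (Fin m))) : ℝ :=
  P.Ψ (z.1 P.T)

/-- The values of the objective of the linearized problem at the pair `z = (x, u₀)`, over all its
feasible variations `(δx, δu)`. -/
def linValues (z : (ℝ → EuclideanSpace ℝ (Fin n)) × (ℝ → EuclideanSpace ℝ (Fin m))) : Set ℝ :=
  {v | ∃ (δx : ℝ → EuclideanSpace ℝ (Fin n)) (δu : ℝ → EuclideanSpace ℝ (Fin m)),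
    MemLp δx 2 P.timeMeasure ∧ MemLp δu 2 P.timeMeasure ∧
    P.SolvesFrom δx
      (fun t => P.fx t (z.1 t) (z.2 t) (δx t) + P.fu t (z.1 t) (z.2 t) (δu t)) 0 ∧
    (∀ᵐ t ∂P.timeMeasure, z.2 t + δu t ∈ P.U) ∧
    v = inner ℝ (gradient P.Ψ (z.1 P.T)) (δx P.T)}

/-- The function `θ_{o,l}`: the minimal value of the linearized problem. -/
noncomputable def thetaL
    (z : (ℝ → EuclideanSpace ℝ (Fin n)) × (ℝ → EuclideanSpace ℝ (Fin m))) : ℝ :=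
  sInf (P.linValues z)

/-- `p` solves the costate equation of the pair `z = (x, u₀)` on `[0, T]`, in the sense of
Carathéodory: `p T = ∂Ψ/∂x (x T)` and `p' t = - ∂f/∂x (t, x t, u₀ t)ᵀ p t` for a.e. `t`. -/
def IsCostate (z : (ℝ → EuclideanSpace ℝ (Fin n)) × (ℝ → EuclideanSpace ℝ (Fin m)))
    (p : ℝ → EuclideanSpace ℝ (Fin n)) : Prop :=
  Integrable (fun t => (P.fx t (z.1 t) (z.2 t)).adjoint (p t)) P.timeMeasure ∧
  ∀ t ∈ Icc 0 P.T, p t = gradient P.Ψ (z.1 P.T) +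
    ∫ s in t..P.T, (P.fx s (z.1 s) (z.2 s)).adjoint (p s)

/-- The costate of the pair `z = (x, u₀)`. -/
noncomputable def costate
    (z : (ℝ → EuclideanSpace ℝ (Fin n)) × (ℝ → EuclideanSpace ℝ (Fin m))) :
    ℝ → EuclideanSpace ℝ (Fin n) :=
  Classical.epsilon (P.IsCostate z)

/-- The Hamiltonian `H₀ (t, x, u, p) = pᵀ f (t, x, u)`. -/
noncomputable def hamiltonian (t : ℝ) (x : EuclideanSpace ℝ (Fin n))
    (u : EuclideanSpace ℝ (Fin m)) (p : EuclideanSpace ℝ (Fin n)) : ℝ :=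
  inner ℝ p (P.f t x u)

/-- The values of the integrated Hamiltonian difference at the pair `z = (x, u₀)`, over all
admissible inputs `u`. -/
def hamValues (z : (ℝ → EuclideanSpace ℝ (Fin n)) × (ℝ → EuclideanSpace ℝ (Fin m))) : Set ℝ :=
  {v | ∃ u : ℝ → EuclideanSpace ℝ (Fin m), P.IsInput u ∧
    v = ∫ t in (0 : ℝ)..P.T, (P.hamiltonian t (z.1 t) (u t) (P.costate z t) -
      P.hamiltonian t (z.1 t) (z.2 t) (P.costate z t))}

/-- The function `θ_{o,h}`: the minimal value of the integrated Hamiltonian difference. -/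
noncomputable def thetaH
    (z : (ℝ → EuclideanSpace ℝ (Fin n)) × (ℝ → EuclideanSpace ℝ (Fin m))) : ℝ :=
  sInf (P.hamValues z)

end ControlProblem

/-!
Integrating by parts against the costate, which solves the adjoint of the linearized state
equation, turns the change of the cost under a change `u₀ ↦ u` of the input into the integrated
Hamiltonian difference, up to an error of order `‖u - u₀‖²` in the `L¹` norm; by Gronwall's
inequality the state moves by at most a multiple of this norm. Two families of inputs at `L¹`
distance `O(1 / N)` from `u₀` are compared with a minimizer: needle variations, which follow `u` on
one of `N` intervals of equal length, chosen so that the Hamiltonian difference there is at most its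
average, and, for convex `U`, the convex combinations `u₀ + (u - u₀) / N`. In either case the
first-order term is of order `1 / N` and the error of order `1 / N²`, so the first-order term cannot
be negative. The minima are attained because the integrands can be minimized pointwise by a
measurable choice of `u t ∈ U`.
-/

open scoped NNReal

/-! ### Measurable selection -/

section Selection

variable {α E : Type*}

/-- The set of minimizers of `l` over `A`. -/
def argminOn (A : Set E) (l : E → ℝ) : Set E := {v ∈ A | ∀ w ∈ A, l v ≤ l w}

theorem argminOn_subset (A : Set E) (l : E → ℝ) : argminOn A l ⊆ A := fun _ hv => hv.1

theorem nonempty_argminOn [TopologicalSpace E] {A : Set E} {l : E → ℝ} (hA : IsCompact A)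
    (hne : A.Nonempty) (hl : ContinuousOn l A) : (argminOn A l).Nonempty :=
  let ⟨v, hv, hmin⟩ := hA.exists_isMinOn hne hl
  ⟨v, hv, fun _ hw => hmin hw⟩

theorem isCompact_argminOn [TopologicalSpace E] [T2Space E] {A : Set E} {l : E → ℝ}
    (hA : IsCompact A) (hl : ContinuousOn l A) : IsCompact (argminOn A l) := by
  rcases (argminOn A l).eq_empty_or_nonempty with hempty | ⟨v, hv, hmin⟩
  · exact hempty ▸ isCompact_empty
  have hsublevel : argminOn A l = A ∩ l ⁻¹' Iic (l v) :=
    Subset.antisymm (fun w hw => ⟨hw.1, hw.2 v hv⟩)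
      fun w hw => ⟨hw.1, fun x hx => hw.2.trans (hmin x hx)⟩
  exact hsublevel ▸ hA.of_isClosed_subset
    (hl.preimage_isClosed_of_isClosed hA.isClosed isClosed_Iic) inter_subset_left

/-- Start from `A` and pass successively to the minimizers of `l 0`, `l 1`, and so on. -/
def successiveArgmin (A : α → Set E) (l : ℕ → E → ℝ) : ℕ → α → Set E
  | 0, a => A a
  | n + 1, a => argminOn (successiveArgmin A l n a) (l n)

theorem successiveArgmin_eq {A : α → Set E} {l : ℕ → E → ℝ} {a : α} {v w : E}
    (hv : v ∈ ⋂ n, successiveArgmin A l n a) (hw : w ∈ ⋂ n, successiveArgmin A l n a) (n : ℕ) :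
    l n v = l n w := by
  have hv' : v ∈ argminOn (successiveArgmin A l n a) (l n) := mem_iInter.1 hv (n + 1)
  have hw' : w ∈ argminOn (successiveArgmin A l n a) (l n) := mem_iInter.1 hw (n + 1)
  exact le_antisymm (hv'.2 w hw'.1) (hw'.2 v hv'.1)

variable [MeasurableSpace α]

/-- A weakly measurable multifunction with nonempty compact values, the setting in which
measurable selections are constructed: the values hit every closed set measurably. -/
structure MeasurableCompactValued [TopologicalSpace E] (A : α → Set E) : Prop where
  isCompact : ∀ a, IsCompact (A a)
  nonempty : ∀ a, (A a).Nonempty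
  measurableSet : ∀ K, IsClosed K → MeasurableSet {a | (A a ∩ K).Nonempty}

namespace MeasurableCompactValued

section T2

variable [TopologicalSpace E] [T2Space E]

protected theorem argminOn {A : α → Set E} (hA : MeasurableCompactValued A) {l : E → ℝ}
    (hl : Continuous l) : MeasurableCompactValued fun a => argminOn (A a) l where
  isCompact a := isCompact_argminOn (hA.isCompact a) hl.continuousOn
  nonempty a := nonempty_argminOn (hA.isCompact a) (hA.nonempty a) hl.continuousOn
  measurableSet K hK := by
    -- `K` contains a minimizer iff it meets `A a` and every rational sublevel set of `l` that
    -- meets `A a` already meets `A a ∩ K`.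
    have hiff : {a | (argminOn (A a) l ∩ K).Nonempty} =
        {a | (A a ∩ K).Nonempty} ∩ ⋂ q : ℚ, ({a | (A a ∩ l ⁻¹' Iic ↑q).Nonempty}ᶜ ∪
          {a | (A a ∩ (K ∩ l ⁻¹' Iic ↑q)).Nonempty}) := by
      ext a
      simp only [mem_ofPred_eq, mem_inter_iff, mem_iInter, mem_union, mem_compl_iff]
      constructor
      · rintro ⟨v, ⟨hv, hmin⟩, hvK⟩
        refine ⟨⟨v, hv, hvK⟩, fun q => or_iff_not_imp_left.2 fun hq => ?_⟩
        obtain ⟨w, hw, hwq⟩ := not_not.1 hq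
        exact ⟨v, hv, hvK, (hmin w hw).trans hwq⟩
      · rintro ⟨hne, hq⟩
        obtain ⟨v, hv, hmin⟩ := nonempty_argminOn ((hA.isCompact a).inter_right hK) hne
          hl.continuousOn
        refine ⟨v, ⟨hv.1, fun w hw => le_of_forall_gt_imp_ge_of_dense fun c hc => ?_⟩, hv.2⟩
        obtain ⟨q, hwq, hqc⟩ := exists_rat_btwn hc
        obtain ⟨x, hx, hxK, hxq⟩ := (hq q).resolve_left (not_not.2 ⟨w, hw, hwq.le⟩)
        exact ((hmin x ⟨hx, hxK⟩).trans hxq).trans hqc.le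
    have hsublevel : ∀ q : ℚ, IsClosed (l ⁻¹' Iic ↑q) := fun q => isClosed_Iic.preimage hl
    rw [hiff]
    exact (hA.measurableSet K hK).inter (MeasurableSet.iInter fun q =>
      (hA.measurableSet _ (hsublevel q)).compl.union
        (hA.measurableSet _ (hK.inter (hsublevel q))))

protected theorem iInter {A : ℕ → α → Set E} (hA : ∀ n, MeasurableCompactValued (A n))
    (hanti : ∀ n a, A (n + 1) a ⊆ A n a) : MeasurableCompactValued fun a => ⋂ n, A n a := by
  have hmeet : ∀ K, IsClosed K → ∀ a,
      ((⋂ n, A n a) ∩ K).Nonempty ↔ ∀ n, (A n a ∩ K).Nonempty := by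
    refine fun K hK a => ⟨fun h n => h.mono (inter_subset_inter_left _ (iInter_subset _ n)),
      fun h => ?_⟩
    rw [iInter_inter]
    exact IsCompact.nonempty_iInter_of_sequence_nonempty_isCompact_isClosed _
      (fun n => inter_subset_inter_left _ (hanti n a)) h (((hA 0).isCompact a).inter_right hK)
      fun n => ((hA n).isCompact a).isClosed.inter hK
  refine ⟨fun a => ?_, fun a => ?_, fun K hK => ?_⟩
  · exact ((hA 0).isCompact a).of_isClosed_subset
      (isClosed_iInter fun n => ((hA n).isCompact a).isClosed) (iInter_subset _ 0)
  · simpa using (hmeet univ isClosed_univ a).2 fun n => by simpa using (hA n).nonempty a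
  · simpa only [hmeet K hK, ofPred_forall] using
      MeasurableSet.iInter fun n => (hA n).measurableSet K hK

end T2

theorem iInter_successiveArgmin [TopologicalSpace E] [T2Space E] {A : α → Set E}
    (hA : MeasurableCompactValued A) {l : ℕ → E → ℝ} (hl : ∀ n, Continuous (l n)) :
    MeasurableCompactValued fun a => ⋂ n, successiveArgmin A l n a := by
  refine MeasurableCompactValued.iInter (fun n => ?_) fun n a => argminOn_subset _ _
  induction n with
  | zero => exact hA
  | succ n ih => exact ih.argminOn (hl n)

theorem exists_measurable_selection [MetricSpace E] [TopologicalSpace.SeparableSpace E]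
    [MeasurableSpace E] [BorelSpace E] {A : α → Set E} (hA : MeasurableCompactValued A) :
    ∃ s : α → E, Measurable s ∧ ∀ a, s a ∈ A a := by
  rcases isEmpty_or_nonempty E with _ | _
  · exact ⟨fun a => (hA.nonempty a).some, measurable_of_subsingleton_codomain _,
      fun a => (hA.nonempty a).some_mem⟩
  -- Minimizing the distances to the points of a dense sequence isolates a single point.
  let l : ℕ → E → ℝ := fun n v => dist v (TopologicalSpace.denseSeq E n)
  have hB := hA.iInter_successiveArgmin (l := l) fun n => by fun_prop
  have huniq : ∀ a, (⋂ n, successiveArgmin A l n a).Subsingleton := by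
    intro a v hv w hw
    have hdist : (fun x => dist v x) = fun x => dist w x :=
      Continuous.ext_on (TopologicalSpace.denseRange_denseSeq E) (by fun_prop) (by fun_prop)
        (forall_mem_range.2 (successiveArgmin_eq hv hw))
    simpa [eq_comm] using congrFun hdist v
  choose s hs using hB.nonempty
  refine ⟨s, measurable_of_isClosed fun K hK => ?_, fun a => mem_iInter.1 (hs a) 0⟩
  convert hB.measurableSet K hK using 1
  ext a
  exact ⟨fun h => ⟨s a, hs a, h⟩, fun ⟨v, hv, hvK⟩ => mem_preimage.2 (huniq a (hs a) hv ▸ hvK)⟩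

end MeasurableCompactValued

theorem exists_measurable_argmin {Y : Type*} [TopologicalSpace Y] [MeasurableSpace Y]
    [OpensMeasurableSpace Y] [MetricSpace E] [TopologicalSpace.SeparableSpace E]
    [MeasurableSpace E] [BorelSpace E] {U : Set E} (hU : IsCompact U) (hne : U.Nonempty)
    {φ : Y → E → ℝ} (hφ : ContinuousOn (Function.uncurry φ) (univ ×ˢ U)) :
    ∃ s : Y → E, Measurable s ∧ ∀ y, s y ∈ argminOn U (φ y) := by
  have hφ_right : ∀ y, ContinuousOn (φ y) U := fun y =>
    hφ.comp (by fun_prop : Continuous fun v => (y, v)).continuousOn fun v hv => ⟨mem_univ y, hv⟩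
  have hφ_left : ∀ v ∈ U, Continuous fun y => φ y v := fun v hv =>
    hφ.comp_continuous (by fun_prop : Continuous fun y => (y, v)) fun y => ⟨mem_univ y, hv⟩
  refine MeasurableCompactValued.exists_measurable_selection
    ⟨fun y => isCompact_argminOn hU (hφ_right y), fun y => nonempty_argminOn hU hne (hφ_right y),
      fun K hK => IsClosed.measurableSet ?_⟩
  -- The pairs of a `y` and a minimizer of `φ y` in the compact set `U ∩ K` form a closed set.
  have : CompactSpace ↥(U ∩ K) := isCompact_iff_compactSpace.1 (hU.inter_right hK)
  let graph : Set (Y × ↥(U ∩ K)) := {q | ∀ w ∈ U, φ q.1 q.2 ≤ φ q.1 w}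
  have hgraph : IsClosed graph := by
    have hφ_graph : Continuous fun q : Y × ↥(U ∩ K) => φ q.1 q.2 :=
      hφ.comp_continuous (by fun_prop : Continuous fun q : Y × ↥(U ∩ K) => (q.1, (q.2 : E)))
        fun q => ⟨mem_univ q.1, q.2.2.1⟩
    simp only [graph, ofPred_forall]
    exact isClosed_biInter fun w hw =>
      isClosed_le hφ_graph ((hφ_left w hw).comp continuous_fst)
  convert isClosedMap_fst_of_compactSpace _ hgraph using 1
  ext y
  constructor
  · rintro ⟨v, ⟨hv, hmin⟩, hvK⟩
    exact ⟨(y, ⟨v, hv, hvK⟩), hmin, rfl⟩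
  · rintro ⟨⟨y, v⟩, hmin, rfl⟩
    exact ⟨v, ⟨v.2.1, hmin⟩, v.2.2⟩

end Selection

/-! ### Primitives on `[0, T]` -/

section Primitive

theorem intervalIntegrable_of_integrableOn_Icc {E : Type*} [NormedAddCommGroup E] {T : ℝ}
    {g : ℝ → E} (hg : IntegrableOn g (Icc 0 T)) {s t : ℝ}
    (hs : s ∈ Icc 0 T) (ht : t ∈ Icc 0 T) : IntervalIntegrable g volume s t :=
  (hg.mono_set (uIcc_subset_Icc hs ht)).intervalIntegrable

theorem measurePreserving_reflect (T : ℝ) :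
    MeasurePreserving (T - ·) (volume.restrict (Icc 0 T)) (volume.restrict (Icc 0 T)) := by
  simpa using (Measure.measurePreserving_sub_left volume T).restrict_preimage
    (measurableSet_Icc (a := 0) (b := T))

theorem sub_mem_Icc_zero {T t : ℝ} (ht : t ∈ Icc 0 T) : T - t ∈ Icc 0 T :=
  ⟨sub_nonneg.2 ht.2, sub_le_self T ht.1⟩

variable {E F : Type*} [NormedAddCommGroup E] [NormedSpace ℝ E] [NormedAddCommGroup F]
  [NormedSpace ℝ F] {T : ℝ} {y z g h : ℝ → E} {a b : E}

/-- `y` is, on `[0, T]`, the absolutely continuous function with initial value `a` and derivative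
`g`, which is required to be integrable. -/
def IsPrimitiveFrom (T : ℝ) (y g : ℝ → E) (a : E) : Prop :=
  IntegrableOn g (Icc 0 T) ∧ ∀ t ∈ Icc 0 T, y t = a + ∫ s in (0 : ℝ)..t, g s

/-- `y` is, on `[0, T]`, the absolutely continuous function with final value `b` and derivative
`-g`, where `g` is required to be integrable. -/
def IsPrimitiveTo (T : ℝ) (y g : ℝ → E) (b : E) : Prop :=
  IntegrableOn g (Icc 0 T) ∧ ∀ t ∈ Icc 0 T, y t = b + ∫ s in t..T, g s

namespace IsPrimitiveFrom

theorem intervalIntegrable (hy : IsPrimitiveFrom T y g a) (hT : 0 ≤ T) :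
    IntervalIntegrable g volume 0 T :=
  intervalIntegrable_of_integrableOn_Icc hy.1 (left_mem_Icc.2 hT) (right_mem_Icc.2 hT)

theorem continuousOn (hy : IsPrimitiveFrom T y g a) : ContinuousOn y (Icc 0 T) := by
  rcases lt_or_ge T 0 with hT | hT
  · simp [Icc_eq_empty_of_lt hT]
  · have hprim := intervalIntegral.continuousOn_primitive_interval (uIcc_of_le hT ▸ hy.1)
    exact (continuousOn_const.add (uIcc_of_le hT ▸ hprim)).congr hy.2

theorem sub (hy : IsPrimitiveFrom T y g a) (hz : IsPrimitiveFrom T z h b) :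
    IsPrimitiveFrom T (y - z) (g - h) (a - b) := by
  refine ⟨hy.1.sub hz.1, fun t ht => ?_⟩
  have h0 : (0 : ℝ) ∈ Icc 0 T := left_mem_Icc.2 (ht.1.trans ht.2)
  simp only [Pi.sub_apply]
  rw [hy.2 t ht, hz.2 t ht, intervalIntegral.integral_sub
    (intervalIntegrable_of_integrableOn_Icc hy.1 h0 ht)
    (intervalIntegrable_of_integrableOn_Icc hz.1 h0 ht)]
  abel

theorem clm_comp [CompleteSpace E] [CompleteSpace F] (hy : IsPrimitiveFrom T y g a)
    (A : E →L[ℝ] F) :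
    IsPrimitiveFrom T (fun t => A (y t)) (fun t => A (g t)) (A a) := by
  refine ⟨A.integrable_comp hy.1, fun t ht => ?_⟩
  simp only
  rw [hy.2 t ht, map_add, A.intervalIntegral_comp_comm (intervalIntegrable_of_integrableOn_Icc hy.1
    (left_mem_Icc.2 (ht.1.trans ht.2)) ht)]

end IsPrimitiveFrom

namespace IsPrimitiveTo

theorem apply_end (hy : IsPrimitiveTo T y g b) (hT : 0 ≤ T) : y T = b := by
  simpa using hy.2 T (right_mem_Icc.2 hT)

theorem isPrimitiveFrom (hy : IsPrimitiveTo T y g b) : IsPrimitiveFrom T y (-g) (y 0) := by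
  refine ⟨hy.1.neg, fun t ht => ?_⟩
  have hT : 0 ≤ T := ht.1.trans ht.2
  have h0 : (0 : ℝ) ∈ Icc 0 T := left_mem_Icc.2 hT
  rw [hy.2 t ht, hy.2 0 h0, ← intervalIntegral.integral_add_adjacent_intervals
    (intervalIntegrable_of_integrableOn_Icc hy.1 h0 ht)
    (intervalIntegrable_of_integrableOn_Icc hy.1 ht (right_mem_Icc.2 hT))]
  simp only [Pi.neg_apply, intervalIntegral.integral_neg]
  abel

theorem sub (hy : IsPrimitiveTo T y g a) (hz : IsPrimitiveTo T z h b) :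
    IsPrimitiveTo T (y - z) (g - h) (a - b) := by
  refine ⟨hy.1.sub hz.1, fun t ht => ?_⟩
  have hT : T ∈ Icc 0 T := right_mem_Icc.2 (ht.1.trans ht.2)
  simp only [Pi.sub_apply]
  rw [hy.2 t ht, hz.2 t ht, intervalIntegral.integral_sub
    (intervalIntegrable_of_integrableOn_Icc hy.1 ht hT)
    (intervalIntegrable_of_integrableOn_Icc hz.1 ht hT)]
  abel

end IsPrimitiveTo

theorem IsPrimitiveFrom.reflect (hy : IsPrimitiveFrom T y g a) :
    IsPrimitiveTo T (fun t => y (T - t)) (fun t => g (T - t)) a :=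
  ⟨(measurePreserving_reflect T).integrable_comp_of_integrable hy.1, fun t ht => by
    simp [hy.2 _ (sub_mem_Icc_zero ht), intervalIntegral.integral_comp_sub_left]⟩

theorem IsPrimitiveTo.reflect (hy : IsPrimitiveTo T y g b) :
    IsPrimitiveFrom T (fun t => y (T - t)) (fun t => g (T - t)) b :=
  ⟨(measurePreserving_reflect T).integrable_comp_of_integrable hy.1, fun t ht => by
    simp [hy.2 _ (sub_mem_Icc_zero ht), intervalIntegral.integral_comp_sub_left]⟩

theorem IsPrimitiveFrom.integral_deriv_mul_add_mul_deriv {y z g h : ℝ → ℝ} {a b : ℝ} (hT : 0 ≤ T)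
    (hy : IsPrimitiveFrom T y g a) (hz : IsPrimitiveFrom T z h b) :
    ∫ t in (0 : ℝ)..T, (g t * z t + y t * h t) = y T * z T - a * b := by
  have hg := hy.intervalIntegrable hT
  have hh := hz.intervalIntegrable hT
  let Y : ℝ → ℝ := fun t => a + ∫ s in (0 : ℝ)..t, g s
  let Z : ℝ → ℝ := fun t => b + ∫ s in (0 : ℝ)..t, h s
  have hconst : ∀ c : ℝ, AbsolutelyContinuousOnInterval (fun _ => c) 0 T := fun c =>
    (LipschitzWith.const c).lipschitzOnWith.absolutelyContinuousOnInterval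
  have hY : AbsolutelyContinuousOnInterval Y 0 T :=
    (hconst a).add (hg.absolutelyContinuousOnInterval_intervalIntegral left_mem_uIcc)
  have hZ : AbsolutelyContinuousOnInterval Z 0 T :=
    (hconst b).add (hh.absolutelyContinuousOnInterval_intervalIntegral left_mem_uIcc)
  calc ∫ t in (0 : ℝ)..T, (g t * z t + y t * h t)
      = ∫ t in (0 : ℝ)..T, (deriv Y t * Z t + Y t * deriv Z t) := by
        refine intervalIntegral.integral_congr_ae ?_
        filter_upwards [hg.ae_hasDerivAt_integral, hh.ae_hasDerivAt_integral] with t htg hth ht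
        have ht' := uIoc_subset_uIcc ht
        rw [((htg ht' 0 left_mem_uIcc).const_add a).deriv,
          ((hth ht' 0 left_mem_uIcc).const_add b).deriv,
          hy.2 t (uIcc_of_le hT ▸ ht'), hz.2 t (uIcc_of_le hT ▸ ht')]
    _ = y T * z T - a * b := by
        rw [hY.integral_deriv_mul_eq_sub hZ, hy.2 T (right_mem_Icc.2 hT),
          hz.2 T (right_mem_Icc.2 hT)]
        simp [Y, Z]

theorem IsPrimitiveFrom.integral_inner_deriv_add_inner_deriv {E : Type*} [NormedAddCommGroup E]
    [InnerProductSpace ℝ E] [FiniteDimensional ℝ E] {y z g h : ℝ → E} {a b : E} (hT : 0 ≤ T)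
    (hy : IsPrimitiveFrom T y g a) (hz : IsPrimitiveFrom T z h b) :
    ∫ t in (0 : ℝ)..T, (inner ℝ (g t) (z t) + inner ℝ (y t) (h t)) =
      inner ℝ (y T) (z T) - inner ℝ a b := by
  let e := stdOrthonormalBasis ℝ E
  have hcoord : ∀ v w : E, inner ℝ v w = ∑ i, innerSL ℝ (e i) v * innerSL ℝ (e i) w := fun v w => by
    simp only [innerSL_apply_apply, ← e.sum_inner_mul_inner v w, real_inner_comm v]
  have hparts := fun i => IsPrimitiveFrom.integral_deriv_mul_add_mul_deriv hT
    (hy.clm_comp (innerSL ℝ (e i))) (hz.clm_comp (innerSL ℝ (e i)))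
  simp only [hcoord, ← Finset.sum_add_distrib, ← Finset.sum_sub_distrib]
  rw [intervalIntegral.integral_finsetSum]
  · exact Finset.sum_congr rfl fun i _ => hparts i
  · intro i _
    have hyi := hy.clm_comp (innerSL ℝ (e i))
    have hzi := hz.clm_comp (innerSL ℝ (e i))
    exact ((hyi.intervalIntegrable hT).mul_continuousOn (uIcc_of_le hT ▸ hzi.continuousOn)).add
      ((hzi.intervalIntegrable hT).continuousOn_mul (uIcc_of_le hT ▸ hyi.continuousOn))

end Primitive

/-! ### Integral equations on `[0, T]` -/

section Gronwall

theorem le_mul_exp_of_le_add_mul_integral {T L K : ℝ} (hL : 0 ≤ L) {d : ℝ → ℝ}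
    (hd : ContinuousOn d (Icc 0 T))
    (hle : ∀ t ∈ Icc 0 T, d t ≤ K + L * ∫ s in (0 : ℝ)..t, d s) :
    ∀ t ∈ Icc 0 T, d t ≤ K * Real.exp (L * t) := by
  intro t ht
  have hint : IntegrableOn d (Icc 0 T) := hd.integrableOn_Icc
  have hprim : IsPrimitiveFrom T (fun t => ∫ s in (0 : ℝ)..t, d s) d 0 :=
    ⟨hint, fun t _ => (zero_add _).symm⟩
  have hderiv : ∀ t ∈ Ico 0 T,
      HasDerivWithinAt (fun t => ∫ s in (0 : ℝ)..t, d s) (d t) (Ici t) t := by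
    intro t ht
    have hnhds : Icc 0 T ∈ nhdsWithin t (Ioi t) := Icc_mem_nhdsGT_of_mem ht
    exact intervalIntegral.integral_hasDerivWithinAt_right
      (intervalIntegrable_of_integrableOn_Icc hint (left_mem_Icc.2 (ht.1.trans ht.2.le))
        (Ico_subset_Icc_self ht))
      ⟨_, hnhds, hint.aestronglyMeasurable⟩
      ((hd t (Ico_subset_Icc_self ht)).mono_of_mem_nhdsWithin hnhds)
  have hgronwall := le_gronwallBound_of_liminf_deriv_right_le hprim.continuousOn
    (fun t ht r => (hderiv t ht).liminf_right_slope_le) (δ := 0) (by simp)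
    (fun t ht => (hle t ⟨ht.1, ht.2.le⟩).trans_eq (add_comm _ _)) t ht
  calc d t ≤ K + L * gronwallBound 0 L K (t - 0) :=
        (hle t ht).trans (by gcongr)
    _ = K * Real.exp (L * t) := by
        rw [sub_zero]
        rcases eq_or_ne L 0 with rfl | hL0
        · simp
        · rw [gronwallBound_of_K_ne_0 hL0]
          field_simp
          ring

end Gronwall

section Caratheodory

variable {E : Type*} [NormedAddCommGroup E] {T : ℝ} {L : ℝ≥0}

/-- A time-dependent vector field that satisfies the hypotheses of Carathéodory's existence and
uniqueness theorem on `[0, T]`. Measurability in `t` is required along continuous curves. -/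
structure IsCaratheodoryField (T : ℝ) (L : ℝ≥0) (g : ℝ → E → E) : Prop where
  aestronglyMeasurable : ∀ y : ℝ → E, Continuous y →
    AEStronglyMeasurable (fun t => g t (y t)) (volume.restrict (Icc 0 T))
  lipschitzWith : ∀ᵐ t ∂volume.restrict (Icc 0 T), LipschitzWith L (g t)
  integrableOn_zero : IntegrableOn (fun t => g t 0) (Icc 0 T)

namespace IsCaratheodoryField

variable {g : ℝ → E → E}

theorem integrableOn (hg : IsCaratheodoryField T L g) {y : ℝ → E} (hy : Continuous y) :
    IntegrableOn (fun t => g t (y t)) (Icc 0 T) := by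
  have hy_int : IntegrableOn (fun t => L * ‖y t‖) (Icc 0 T) :=
    (by fun_prop : Continuous fun t => L * ‖y t‖).continuousOn.integrableOn_Icc
  refine (hg.integrableOn_zero.norm.add hy_int).mono' (hg.aestronglyMeasurable y hy) ?_
  filter_upwards [hg.lipschitzWith] with t ht
  calc ‖g t (y t)‖ ≤ ‖g t 0‖ + ‖g t (y t) - g t 0‖ := norm_le_insert' _ _
    _ ≤ ‖g t 0‖ + L * ‖y t‖ := by gcongr; simpa using ht.norm_sub_le (y t) 0

theorem reflect (hg : IsCaratheodoryField T L g) :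
    IsCaratheodoryField T L fun t => g (T - t) where
  aestronglyMeasurable y hy := by
    simpa [Function.comp_def] using (hg.aestronglyMeasurable (fun t => y (T - t)) (by fun_prop))
      |>.comp_measurePreserving (measurePreserving_reflect T)
  lipschitzWith := (measurePreserving_reflect T).quasiMeasurePreserving.ae hg.lipschitzWith
  integrableOn_zero := (measurePreserving_reflect T).integrable_comp_of_integrable
    hg.integrableOn_zero

end IsCaratheodoryField

variable [NormedSpace ℝ E]

theorem IsPrimitiveFrom.norm_le {y g : ℝ → E} {a : E} {β : ℝ → ℝ} (hy : IsPrimitiveFrom T y g a)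
    (hβ : IntegrableOn β (Icc 0 T)) (hβ0 : 0 ≤ β)
    (hg : ∀ᵐ t ∂volume.restrict (Icc 0 T), ‖g t‖ ≤ β t + L * ‖y t‖) :
    ∀ t ∈ Icc 0 T, ‖y t‖ ≤ (‖a‖ + ∫ s in (0 : ℝ)..T, β s) * Real.exp (L * t) := by
  have hcont := hy.continuousOn.norm
  have hint : IntegrableOn (fun s => ‖y s‖) (Icc 0 T) := hcont.integrableOn_Icc
  refine le_mul_exp_of_le_add_mul_integral L.2 hcont fun t ht => ?_
  have h0 : (0 : ℝ) ∈ Icc 0 T := left_mem_Icc.2 (ht.1.trans ht.2)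
  have hβt := intervalIntegrable_of_integrableOn_Icc hβ h0 ht
  have hyt := intervalIntegrable_of_integrableOn_Icc hint h0 ht
  have hβ_mono : ∫ s in (0 : ℝ)..t, β s ≤ ∫ s in (0 : ℝ)..T, β s :=
    intervalIntegral.integral_mono_interval le_rfl ht.1 ht.2
      (Filter.Eventually.of_forall hβ0)
      (intervalIntegrable_of_integrableOn_Icc hβ h0 (right_mem_Icc.2 (ht.1.trans ht.2)))
  have hg_le : ∀ᵐ s, s ∈ Ioc 0 t → ‖g s‖ ≤ β s + L * ‖y s‖ := by
    filter_upwards [(ae_restrict_iff' measurableSet_Icc).1 hg] with s hs hst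
    exact hs ⟨hst.1.le, hst.2.trans ht.2⟩
  calc ‖y t‖ ≤ ‖a‖ + ‖∫ s in (0 : ℝ)..t, g s‖ := hy.2 t ht ▸ norm_add_le _ _
    _ ≤ ‖a‖ + ∫ s in (0 : ℝ)..t, (β s + L * ‖y s‖) := by
      gcongr
      exact intervalIntegral.norm_integral_le_of_norm_le ht.1 hg_le (hβt.add (hyt.const_mul L))
    _ = ‖a‖ + (∫ s in (0 : ℝ)..t, β s) + L * ∫ s in (0 : ℝ)..t, ‖y s‖ := by
      rw [intervalIntegral.integral_add hβt (hyt.const_mul L),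
        intervalIntegral.integral_const_mul, add_assoc]
    _ ≤ (‖a‖ + ∫ s in (0 : ℝ)..T, β s) + L * ∫ s in (0 : ℝ)..t, ‖y s‖ := by
      gcongr (_ + ?_) + _

theorem IsPrimitiveTo.eqOn {g : ℝ → E → E} {y z : ℝ → E} {b : E}
    (hg : ∀ᵐ t ∂volume.restrict (Icc 0 T), LipschitzWith L (g t))
    (hy : IsPrimitiveTo T y (fun t => g t (y t)) b)
    (hz : IsPrimitiveTo T z (fun t => g t (z t)) b) : EqOn y z (Icc 0 T) := by
  intro t ht
  have hzero := (hy.sub hz).reflect.norm_le (L := L) (β := 0) integrableOn_zero le_rfl (by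
    filter_upwards [(measurePreserving_reflect T).quasiMeasurePreserving.ae hg] with s hs
    simpa using hs.norm_sub_le (y (T - s)) (z (T - s))) _ (sub_mem_Icc_zero ht)
  simpa [sub_eq_zero] using hzero

namespace IsCaratheodoryField

variable {g : ℝ → E → E}

/-- The Picard iteration map of the initial value problem `y' = g t y`, `y 0 = a` on `[0, T]`. -/
noncomputable def picard (hT : 0 ≤ T) (hg : IsCaratheodoryField T L g) (a : E)
    (z : C(Icc 0 T, E)) : C(Icc 0 T, E) where
  toFun t := a + ∫ s in (0 : ℝ)..t, g s (IccExtend hT z s)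
  continuous_toFun := continuousOn_iff_continuous_domRestrict.1 (IsPrimitiveFrom.continuousOn
    ⟨hg.integrableOn z.continuous.Icc_extend', fun _ _ => rfl⟩)

theorem dist_picard_le {hT : 0 ≤ T} (hg : IsCaratheodoryField T L g) (a : E) {z w : C(Icc 0 T, E)}
    {ρ : ℝ → ℝ} (hρ : Continuous ρ) (hzw : ∀ t : Icc 0 T, dist (z t) (w t) ≤ ρ t) (t : Icc 0 T) :
    dist (picard hT hg a z t) (picard hT hg a w t) ≤ ∫ s in (0 : ℝ)..t, L * ρ s := by
  have h0 : (0 : ℝ) ∈ Icc 0 T := left_mem_Icc.2 hT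
  have hint : ∀ z : C(Icc 0 T, E),
      IntervalIntegrable (fun s => g s (IccExtend hT z s)) volume 0 t := fun z =>
    intervalIntegrable_of_integrableOn_Icc (hg.integrableOn z.continuous.Icc_extend') h0 t.2
  change dist (a + _) (a + _) ≤ _
  rw [dist_add_left, dist_eq_norm, ← intervalIntegral.integral_sub (hint z) (hint w)]
  refine intervalIntegral.norm_integral_le_of_norm_le t.2.1 ?_
    (by apply Continuous.intervalIntegrable; fun_prop)
  filter_upwards [(ae_restrict_iff' measurableSet_Icc).1 hg.lipschitzWith] with s hs hst
  have hsT : s ∈ Icc 0 T := ⟨hst.1.le, hst.2.trans t.2.2⟩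
  calc _ ≤ L * ‖IccExtend hT z s - IccExtend hT w s‖ := (hs hsT).norm_sub_le _ _
    _ ≤ L * ρ s := by
      gcongr
      simpa [IccExtend_of_mem hT _ hsT, dist_eq_norm] using hzw ⟨s, hsT⟩

theorem dist_iterate_picard_le {hT : 0 ≤ T} (hg : IsCaratheodoryField T L g) (a : E)
    (z w : C(Icc 0 T, E)) (k : ℕ) (t : Icc 0 T) :
    dist ((picard hT hg a)^[k] z t) ((picard hT hg a)^[k] w t) ≤
      (L * t) ^ k / k.factorial * dist z w := by
  induction k generalizing t with
  | zero => simpa using ContinuousMap.dist_apply_le_dist t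
  | succ k ih =>
    rw [Function.iterate_succ_apply', Function.iterate_succ_apply']
    refine (hg.dist_picard_le a (ρ := fun s => (L * s) ^ k / k.factorial * dist z w)
      (by fun_prop) ih t).trans_eq ?_
    have hfactor : ∀ s : ℝ, L * ((L * s) ^ k / k.factorial * dist z w) =
        L ^ (k + 1) / k.factorial * dist z w * s ^ k := fun s => by ring
    simp only [hfactor, intervalIntegral.integral_const_mul, integral_pow,
      zero_pow k.succ_ne_zero, sub_zero, Nat.factorial_succ]
    push_cast
    field_simp
    ring

theorem exists_isFixedPt_picard [CompleteSpace E] (hT : 0 ≤ T) (hg : IsCaratheodoryField T L g)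
    (a : E) : ∃ z, Function.IsFixedPt (picard hT hg a) z := by
  have hlim := FloorSemiring.tendsto_pow_div_factorial_atTop ((L : ℝ) * T)
  obtain ⟨k, hk⟩ := (hlim.eventually (gt_mem_nhds one_pos)).exists
  have hk0 : 0 ≤ (L * T) ^ k / (k.factorial : ℝ) := by positivity
  have hcontr : ContractingWith ⟨(L * T) ^ k / k.factorial, hk0⟩ (picard hT hg a)^[k] := by
    refine ⟨hk, LipschitzWith.of_dist_le_mul fun z w => ?_⟩
    rw [ContinuousMap.dist_le (by positivity)]
    intro t
    refine (hg.dist_iterate_picard_le a z w k t).trans ?_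
    have := t.2.1
    change _ ≤ (L * T) ^ k / k.factorial * dist z w
    gcongr
    exact t.2.2
  exact ⟨_, hcontr.isFixedPt_fixedPoint_iterate⟩

theorem exists_isPrimitiveFrom [CompleteSpace E] (hT : 0 ≤ T) (hg : IsCaratheodoryField T L g)
    (a : E) : ∃ y, IsPrimitiveFrom T y (fun t => g t (y t)) a := by
  obtain ⟨z, hz⟩ := exists_isFixedPt_picard hT hg a
  refine ⟨IccExtend hT z, hg.integrableOn z.continuous.Icc_extend', fun t ht => ?_⟩
  rw [IccExtend_of_mem hT z ht]
  exact (DFunLike.congr_fun hz ⟨t, ht⟩).symm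

theorem exists_isPrimitiveTo [CompleteSpace E] (hT : 0 ≤ T) (hg : IsCaratheodoryField T L g)
    (b : E) : ∃ y, IsPrimitiveTo T y (fun t => g t (y t)) b := by
  obtain ⟨y, hy⟩ := hg.reflect.exists_isPrimitiveFrom hT b
  exact ⟨fun t => y (T - t), by simpa using hy.reflect⟩

theorem of_clm {A : ℝ → E →L[ℝ] E} {c : ℝ → E}
    (hA : AEStronglyMeasurable A (volume.restrict (Icc 0 T)))
    (hAL : ∀ᵐ t ∂volume.restrict (Icc 0 T), ‖A t‖ ≤ L) (hc : IntegrableOn c (Icc 0 T)) :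
    IsCaratheodoryField T L fun t y => A t y + c t where
  aestronglyMeasurable y hy :=
    ((ContinuousLinearMap.id ℝ _).aestronglyMeasurable_comp₂ hA hy.aestronglyMeasurable).add
      hc.aestronglyMeasurable
  lipschitzWith := hAL.mono fun t ht => lipschitzWith_iff_norm_sub_le.2 fun y z => by
    simpa only [add_sub_add_right_eq_sub, ← map_sub] using (A t).le_of_opNorm_le ht (y - z)
  integrableOn_zero := by simpa using hc

end IsCaratheodoryField

end Caratheodory

section Calculus

theorem norm_image_sub_sub_fderiv_le {E F : Type*} [NormedAddCommGroup E] [NormedSpace ℝ E]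
    [NormedAddCommGroup F] [NormedSpace ℝ F] {f : E → F} {s : Set E} {L : ℝ≥0} {x y : E}
    (hs : Convex ℝ s) (hf : ∀ x ∈ s, DifferentiableAt ℝ f x)
    (hlip : LipschitzOnWith L (fderiv ℝ f) s) (hx : x ∈ s) (hy : y ∈ s) :
    ‖f y - f x - fderiv ℝ f x (y - x)‖ ≤ L * ‖y - x‖ ^ 2 := by
  have hsub : segment ℝ x y ⊆ s := hs.segment_subset hx hy
  have hderiv : ∀ w ∈ segment ℝ x y, ‖fderiv ℝ f w - fderiv ℝ f x‖ ≤ L * ‖y - x‖ := fun w hw =>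
    (hlip.norm_sub_le (hsub hw) hx).trans (by gcongr; exact norm_sub_le_of_mem_segment hw)
  calc ‖f y - f x - fderiv ℝ f x (y - x)‖ ≤ L * ‖y - x‖ * ‖y - x‖ :=
        (convex_segment x y).norm_image_sub_le_of_norm_fderiv_le' (fun w hw => hf w (hsub hw))
          hderiv (left_mem_segment ℝ x y) (right_mem_segment ℝ x y)
    _ = L * ‖y - x‖ ^ 2 := by ring

theorem nonneg_of_forall_nonneg_div_add_div_sq {v K : ℝ}
    (h : ∀ N : ℕ, 0 < N → 0 ≤ v / N + K / (N : ℝ) ^ 2) : 0 ≤ v := by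
  have hlim : Filter.Tendsto (fun N : ℕ => v + K / N) Filter.atTop (nhds (v + 0)) :=
    tendsto_const_nhds.add (tendsto_const_div_atTop_nhds_zero_nat K)
  rw [add_zero] at hlim
  refine ge_of_tendsto hlim ((Filter.eventually_gt_atTop 0).mono fun N hN => ?_)
  have hN' : (0 : ℝ) < N := Nat.cast_pos.2 hN
  calc 0 ≤ N * (v / N + K / (N : ℝ) ^ 2) := mul_nonneg hN'.le (h N hN)
    _ = v + K / N := by field_simp

theorem exists_intervalIntegral_le_div {T : ℝ} (hT : 0 ≤ T) {g : ℝ → ℝ}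
    (hg : IntegrableOn g (Icc 0 T)) {N : ℕ} (hN : 0 < N) :
    ∃ a ∈ Icc 0 T, ∃ b ∈ Icc a T, b - a = T / N ∧
      ∫ t in a..b, g t ≤ (∫ t in (0 : ℝ)..T, g t) / N := by
  have hN' : (N : ℝ) ≠ 0 := Nat.cast_ne_zero.2 hN.ne'
  let node : ℕ → ℝ := fun k => k * (T / N)
  have node_zero : node 0 = 0 := by simp [node]
  have node_last : node N = T := mul_div_cancel₀ T hN'
  have node_mono : Monotone node := fun i j hij => by dsimp only [node]; gcongr
  have node_mem : ∀ k ≤ N, node k ∈ Icc 0 T := fun k hk =>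
    ⟨node_zero ▸ node_mono k.zero_le, node_last ▸ node_mono hk⟩
  have hsum : ∑ k ∈ Finset.range N, ∫ t in (node k)..(node (k + 1)), g t =
      ∫ t in (0 : ℝ)..T, g t := by
    rw [intervalIntegral.sum_integral_adjacent_intervals, node_zero, node_last]
    exact fun k hk => intervalIntegrable_of_integrableOn_Icc hg (node_mem k hk.le)
      (node_mem (k + 1) hk)
  obtain ⟨k, hk, hle⟩ : ∃ k ∈ Finset.range N, ∫ t in (node k)..(node (k + 1)), g t ≤
      (∫ t in (0 : ℝ)..T, g t) / N := by
    refine Finset.exists_le_of_sum_le (Finset.nonempty_range_iff.2 hN.ne') ?_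
    rw [hsum, Finset.sum_const, Finset.card_range, nsmul_eq_mul, mul_div_cancel₀ _ hN']
  rw [Finset.mem_range] at hk
  refine ⟨node k, node_mem k hk.le, node (k + 1),
    ⟨node_mono k.le_succ, (node_mem (k + 1) hk).2⟩, ?_, hle⟩
  simp only [node]
  push_cast
  ring

end Calculus

theorem memLp_top_comp_of_continuousOn {α Z Y : Type*} [MeasurableSpace α] {μ : Measure α}
    [IsFiniteMeasure μ] [TopologicalSpace Z] [TopologicalSpace.PseudoMetrizableSpace Z] [T2Space Z]
    [MeasurableSpace Z] [OpensMeasurableSpace Z] [NormedAddCommGroup Y] {K : Set Z}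
    (hK : IsCompact K) {G : Z → Y} (hG : ContinuousOn G K) {φ : α → Z} (hφ : AEMeasurable φ μ)
    (hφK : ∀ᵐ a ∂μ, φ a ∈ K) : MemLp (fun a => G (φ a)) ⊤ μ := by
  obtain ⟨C, hC⟩ := hK.exists_bound_of_continuousOn hG
  have hmeas : AEStronglyMeasurable G (μ.map φ) := by
    rw [← Measure.restrict_eq_self_of_ae_mem ((ae_map_iff hφ hK.measurableSet).2 hφK)]
    exact hG.aestronglyMeasurable_of_isCompact hK hK.measurableSet
  exact memLp_top_of_bound (hmeas.comp_aemeasurable hφ) C (hφK.mono fun a ha => hC _ ha)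

section BoundedIntegrand

variable {α E F : Type*} [MeasurableSpace α] {μ : Measure α} [NormedAddCommGroup E]

theorem integrable_inner_of_memLp_top [InnerProductSpace ℝ E] {p g : α → E} (hp : MemLp p ⊤ μ)
    (hg : Integrable g μ) : Integrable (fun a => inner ℝ (p a) (g a)) μ :=
  memLp_one_iff_integrable.1 ((innerSL ℝ).memLp_of_bilin 1 hp (memLp_one_iff_integrable.2 hg))

theorem integrable_clm_apply_of_memLp_top [NormedSpace ℝ E] [NormedAddCommGroup F]
    [NormedSpace ℝ F] {A : α → E →L[ℝ] F} {y : α → E} (hA : MemLp A ⊤ μ) (hy : Integrable y μ) :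
    Integrable (fun a => A a (y a)) μ :=
  memLp_one_iff_integrable.1
    ((ContinuousLinearMap.id ℝ (E →L[ℝ] F)).memLp_of_bilin 1 hA (memLp_one_iff_integrable.2 hy))

end BoundedIntegrand

theorem isOptimalityFunction_of_isLeast {α : Type*} {X : Set α} {J θ : α → ℝ} {S : α → Set ℝ}
    (hθ : ∀ z ∈ X, IsLeast (S z) (θ z)) (hzero : ∀ z ∈ X, 0 ∈ S z)
    (hnonneg : ∀ z ∈ X, IsMinOn J X z → ∀ v ∈ S z, 0 ≤ v) : IsOptimalityFunction X J θ :=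
  ⟨fun z hz => (hθ z hz).2 (hzero z hz), fun z hz hmin =>
    le_antisymm ((hθ z hz).2 (hzero z hz)) (hnonneg z hz hmin _ (hθ z hz).1)⟩

namespace ControlProblem

variable {n m : ℕ} {P : ControlProblem n m} {L : ℝ≥0}
  {z w : (ℝ → EuclideanSpace ℝ (Fin n)) × (ℝ → EuclideanSpace ℝ (Fin m))}
  {x p : ℝ → EuclideanSpace ℝ (Fin n)} {u v : ℝ → EuclideanSpace ℝ (Fin m)}

/-! ### Regularity along a trajectory -/

section Regularity

instance isFiniteMeasure_timeMeasure : IsFiniteMeasure P.timeMeasure :=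
  inferInstanceAs (IsFiniteMeasure (volume.restrict (Icc 0 P.T)))

theorem ae_mem_Icc : ∀ᵐ t ∂P.timeMeasure, t ∈ Icc 0 P.T :=
  ae_restrict_mem measurableSet_Icc

theorem timeMeasure_real_univ (hT : 0 ≤ P.T) : P.timeMeasure.real univ = P.T := by
  simp [timeMeasure, hT]

theorem intervalIntegral_eq_integral_timeMeasure {E : Type*} [NormedAddCommGroup E]
    [NormedSpace ℝ E] (hT : 0 ≤ P.T) (g : ℝ → E) :
    ∫ t in (0 : ℝ)..P.T, g t = ∫ t, g t ∂P.timeMeasure := by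
  rw [timeMeasure, intervalIntegral.integral_of_le hT, integral_Icc_eq_integral_Ioc]

theorem solvesFrom_iff {y g : ℝ → EuclideanSpace ℝ (Fin n)} {a : EuclideanSpace ℝ (Fin n)} :
    P.SolvesFrom y g a ↔ IsPrimitiveFrom P.T y g a :=
  Iff.rfl

theorem isCostate_iff : P.IsCostate z p ↔ IsPrimitiveTo P.T p
    (fun t => (P.fx t (z.1 t) (z.2 t)).adjoint (p t)) (gradient P.Ψ (z.1 P.T)) :=
  Iff.rfl

theorem continuousOn_of_mem_feasible (hz : z ∈ P.feasible) : ContinuousOn z.1 (Icc 0 P.T) :=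
  (solvesFrom_iff.1 hz.2.2).continuousOn

theorem IsCostate.continuousOn (hp : P.IsCostate z p) : ContinuousOn p (Icc 0 P.T) :=
  (isCostate_iff.1 hp).isPrimitiveFrom.continuousOn

theorem memLp_top_of_continuousOn {E : Type*} [NormedAddCommGroup E] {y : ℝ → E}
    (hy : ContinuousOn y (Icc 0 P.T)) : MemLp y ⊤ P.timeMeasure :=
  memLp_top_comp_of_continuousOn isCompact_Icc hy aemeasurable_id ae_mem_Icc

theorem IsInput.integrable (hu : P.IsInput u) : Integrable u P.timeMeasure :=
  hu.1.integrable one_le_two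

theorem isInput_of_aestronglyMeasurable (hU : IsCompact P.U)
    (hu : AEStronglyMeasurable u P.timeMeasure) (huU : ∀ᵐ t ∂P.timeMeasure, u t ∈ P.U) :
    P.IsInput u := by
  obtain ⟨C, hC⟩ := hU.isBounded.exists_norm_le
  exact ⟨MemLp.of_bound hu C (huU.mono fun t ht => hC _ ht), huU⟩

/-- The set `[0, T] × ℝⁿ × U` on which the data of the problem are regular. -/
def domain (P : ControlProblem n m) :
    Set (ℝ × EuclideanSpace ℝ (Fin n) × EuclideanSpace ℝ (Fin m)) :=
  Icc 0 P.T ×ˢ univ ×ˢ P.U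

variable {Y : Type*} [NormedAddCommGroup Y]
  {G : ℝ → EuclideanSpace ℝ (Fin n) → EuclideanSpace ℝ (Fin m) → Y}

theorem continuousOn_domain
    (hG : ∀ t₁ ∈ Icc 0 P.T, ∀ t₂ ∈ Icc 0 P.T, ∀ x₁ x₂, ∀ u₁ ∈ P.U, ∀ u₂ ∈ P.U,
      ‖G t₁ x₁ u₁ - G t₂ x₂ u₂‖ ≤ L * (|t₁ - t₂| + ‖x₁ - x₂‖ + ‖u₁ - u₂‖)) :
    ContinuousOn (fun q => G q.1 q.2.1 q.2.2) P.domain := by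
  suffices LipschitzOnWith (L * 3) (fun q => G q.1 q.2.1 q.2.2) P.domain from this.continuousOn
  refine LipschitzOnWith.of_dist_le_mul fun q hq r hr => ?_
  have htime : |q.1 - r.1| ≤ dist q r := le_max_left _ _
  have hstate : ‖q.2.1 - r.2.1‖ ≤ dist q r :=
    dist_eq_norm q.2.1 r.2.1 ▸ (le_max_left _ _).trans (le_max_right _ _)
  have hinput : ‖q.2.2 - r.2.2‖ ≤ dist q r :=
    dist_eq_norm q.2.2 r.2.2 ▸ (le_max_right _ _).trans (le_max_right _ _)
  calc dist (G q.1 q.2.1 q.2.2) (G r.1 r.2.1 r.2.2)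
      ≤ L * (|q.1 - r.1| + ‖q.2.1 - r.2.1‖ + ‖q.2.2 - r.2.2‖) :=
        dist_eq_norm (G q.1 q.2.1 q.2.2) _ ▸ hG _ hq.1 _ hr.1 _ _ _ hq.2.2 _ hr.2.2
    _ ≤ L * (dist q r + dist q r + dist q r) := by gcongr
    _ = ↑(L * 3) * dist q r := by push_cast; ring

theorem continuousOn_along (hG : ContinuousOn (fun q => G q.1 q.2.1 q.2.2) P.domain)
    (hx : ContinuousOn x (Icc 0 P.T)) :
    ContinuousOn (fun q : ℝ × EuclideanSpace ℝ (Fin m) => G q.1 (x q.1) q.2)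
      (Icc 0 P.T ×ˢ P.U) :=
  hG.comp (f := fun q : ℝ × EuclideanSpace ℝ (Fin m) => (q.1, x q.1, q.2))
    (continuousOn_fst.prodMk ((hx.comp continuousOn_fst fun _ hq => hq.1).prodMk continuousOn_snd))
    fun _ hq => ⟨hq.1, mem_univ _, hq.2⟩

theorem memLp_top_along (hU : IsCompact P.U)
    (hG : ContinuousOn (fun q => G q.1 q.2.1 q.2.2) P.domain) (hx : ContinuousOn x (Icc 0 P.T))
    (hu : P.IsInput u) : MemLp (fun t => G t (x t) (u t)) ⊤ P.timeMeasure :=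
  memLp_top_comp_of_continuousOn (isCompact_Icc.prod hU) (continuousOn_along hG hx)
    (aemeasurable_id.prodMk hu.1.aestronglyMeasurable.aemeasurable)
    (ae_mem_Icc.and hu.2)

end Regularity

section LipschitzC1With

variable {t : ℝ} {a b : EuclideanSpace ℝ (Fin n)} {c d : EuclideanSpace ℝ (Fin m)}

namespace LipschitzC1With

theorem continuousOn_f (h : P.LipschitzC1With L) :
    ContinuousOn (fun q => P.f q.1 q.2.1 q.2.2) P.domain :=
  continuousOn_domain h.lip_f

theorem continuousOn_fx (h : P.LipschitzC1With L) :
    ContinuousOn (fun q => P.fx q.1 q.2.1 q.2.2) P.domain :=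
  continuousOn_domain h.lip_fx

theorem continuousOn_fu (h : P.LipschitzC1With L) :
    ContinuousOn (fun q => P.fu q.1 q.2.1 q.2.2) P.domain :=
  continuousOn_domain h.lip_fu

theorem lipschitzWith_f (h : P.LipschitzC1With L) (ht : t ∈ Icc 0 P.T) (hc : c ∈ P.U) :
    LipschitzWith L fun x => P.f t x c :=
  lipschitzWith_iff_norm_sub_le.2 fun a b => by simpa using h.lip_f t ht t ht a b c hc c hc

theorem norm_fx_le (h : P.LipschitzC1With L) (ht : t ∈ Icc 0 P.T) (hc : c ∈ P.U) :
    ‖P.fx t a c‖ ≤ L :=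
  norm_fderiv_le_of_lipschitz ℝ (h.lipschitzWith_f ht hc)

theorem Ψ_sub_le (h : P.LipschitzC1With L) (a b : EuclideanSpace ℝ (Fin n)) :
    P.Ψ b - P.Ψ a ≤ inner ℝ (gradient P.Ψ a) (b - a) + L * ‖b - a‖ ^ 2 := by
  have hlip : LipschitzWith L (fderiv ℝ P.Ψ) := lipschitzWith_iff_norm_sub_le.2 fun x y => by
    simpa only [gradient, ← map_sub, LinearIsometryEquiv.norm_map] using h.lip_grad x y
  have htaylor := norm_image_sub_sub_fderiv_le convex_univ (fun x _ => h.diff_Ψ x)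
    hlip.lipschitzOnWith (mem_univ a) (mem_univ b)
  have hgrad : inner ℝ (gradient P.Ψ a) (b - a) = fderiv ℝ P.Ψ a (b - a) := by
    rw [gradient, InnerProductSpace.toDual_symm_apply]
  linarith [(Real.le_norm_self _).trans htaylor]

theorem norm_f_sub_sub_fx_le (h : P.LipschitzC1With L) (ht : t ∈ Icc 0 P.T) (hc : c ∈ P.U)
    (hd : d ∈ P.U) :
    ‖P.f t b d - P.f t a d - P.fx t a c (b - a)‖ ≤
      L * ‖b - a‖ ^ 2 + L * ‖d - c‖ * ‖b - a‖ := by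
  have hlip : LipschitzWith L fun x => P.fx t x d :=
    lipschitzWith_iff_norm_sub_le.2 fun x y => by simpa using h.lip_fx t ht t ht x y d hd d hd
  have htaylor : ‖P.f t b d - P.f t a d - P.fx t a d (b - a)‖ ≤ L * ‖b - a‖ ^ 2 :=
    norm_image_sub_sub_fderiv_le (f := fun x => P.f t x d) convex_univ
      (fun x _ => h.diff_x t ht x d hd) hlip.lipschitzOnWith (mem_univ a) (mem_univ b)
  have hfx : ‖(P.fx t a d - P.fx t a c) (b - a)‖ ≤ L * ‖d - c‖ * ‖b - a‖ :=
    ContinuousLinearMap.le_of_opNorm_le _ (by simpa using h.lip_fx t ht t ht a a d hd c hc) _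
  calc _ = ‖(P.f t b d - P.f t a d - P.fx t a d (b - a)) +
        (P.fx t a d - P.fx t a c) (b - a)‖ := by
        simp only [sub_apply, sub_add_sub_cancel]
    _ ≤ _ := norm_add_le_of_le htaylor hfx

theorem hamiltonian_sub_le (h : P.LipschitzC1With L) (hconv : Convex ℝ P.U) (ht : t ∈ Icc 0 P.T)
    (hc : c ∈ P.U) (hd : d ∈ P.U) :
    P.hamiltonian t a d b - P.hamiltonian t a c b ≤
      inner ℝ b (P.fu t a c (d - c)) + ‖b‖ * (L * ‖d - c‖ ^ 2) := by
  have hlip : LipschitzOnWith L (P.fu t a) P.U := LipschitzOnWith.of_dist_le_mul fun c hc d hd => by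
    simpa [dist_eq_norm] using h.lip_fu t ht t ht a a c hc d hd
  have htaylor : ‖P.f t a d - P.f t a c - P.fu t a c (d - c)‖ ≤ L * ‖d - c‖ ^ 2 :=
    norm_image_sub_sub_fderiv_le hconv (h.diff_u t ht a) hlip hc hd
  have hremainder : inner ℝ b (P.f t a d - P.f t a c - P.fu t a c (d - c)) ≤
      ‖b‖ * (L * ‖d - c‖ ^ 2) := (real_inner_le_norm _ _).trans (by gcongr)
  simp only [inner_sub_right] at hremainder
  simp only [hamiltonian]
  linarith

end LipschitzC1With

end LipschitzC1With

/-! ### Trajectories, costates and variations -/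

section Trajectories

theorem exists_mem_feasible (hT : 0 ≤ P.T) (hU : IsCompact P.U) (h : P.LipschitzC1With L)
    (hu : P.IsInput u) : ∃ x, (x, u) ∈ P.feasible := by
  have hbdd : ∀ y, ContinuousOn y (Icc 0 P.T) →
      MemLp (fun t => P.f t (y t) (u t)) ⊤ P.timeMeasure := fun y hy =>
    memLp_top_along hU h.continuousOn_f hy hu
  have hfield : IsCaratheodoryField P.T L fun t x => P.f t x (u t) :=
    { aestronglyMeasurable := fun y hy => (hbdd y hy.continuousOn).1
      lipschitzWith := by
        filter_upwards [ae_mem_Icc (P := P), hu.2] with t ht hut using h.lipschitzWith_f ht hut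
      integrableOn_zero := (hbdd 0 continuousOn_const).integrable le_top }
  obtain ⟨x, hx⟩ := hfield.exists_isPrimitiveFrom hT P.ξ
  exact ⟨x, (memLp_top_of_continuousOn hx.continuousOn).mono_exponent le_top, hu, hx⟩

theorem memLp_top_fx (hU : IsCompact P.U) (h : P.LipschitzC1With L) (hz : z ∈ P.feasible) :
    MemLp (fun t => P.fx t (z.1 t) (z.2 t)) ⊤ P.timeMeasure :=
  memLp_top_along hU h.continuousOn_fx (continuousOn_of_mem_feasible hz) hz.2.1

theorem memLp_top_fu (hU : IsCompact P.U) (h : P.LipschitzC1With L) (hz : z ∈ P.feasible) :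
    MemLp (fun t => P.fu t (z.1 t) (z.2 t)) ⊤ P.timeMeasure :=
  memLp_top_along hU h.continuousOn_fu (continuousOn_of_mem_feasible hz) hz.2.1

theorem ae_norm_fx_le (h : P.LipschitzC1With L) (hz : z ∈ P.feasible) :
    ∀ᵐ t ∂P.timeMeasure, ‖P.fx t (z.1 t) (z.2 t)‖ ≤ L := by
  filter_upwards [ae_mem_Icc, hz.2.1.2] with t ht hut using h.norm_fx_le ht hut

theorem isCaratheodoryField_costate (hU : IsCompact P.U) (h : P.LipschitzC1With L)
    (hz : z ∈ P.feasible) :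
    IsCaratheodoryField P.T L fun t q => (P.fx t (z.1 t) (z.2 t)).adjoint q := by
  have hmeas : AEStronglyMeasurable (fun t => (P.fx t (z.1 t) (z.2 t)).adjoint) P.timeMeasure :=
    ContinuousLinearMap.adjoint.continuous.comp_aestronglyMeasurable (memLp_top_fx hU h hz).1
  have hnorm : ∀ᵐ t ∂P.timeMeasure, ‖(P.fx t (z.1 t) (z.2 t)).adjoint‖ ≤ L := by
    simpa only [LinearIsometryEquiv.norm_map] using ae_norm_fx_le h hz
  simpa using IsCaratheodoryField.of_clm hmeas hnorm integrableOn_zero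

theorem isCostate_costate (hT : 0 ≤ P.T) (hU : IsCompact P.U) (h : P.LipschitzC1With L)
    (hz : z ∈ P.feasible) : P.IsCostate z (P.costate z) := by
  obtain ⟨p, hp⟩ := (isCaratheodoryField_costate hU h hz).exists_isPrimitiveTo hT
    (gradient P.Ψ (z.1 P.T))
  exact Classical.epsilon_spec ⟨p, isCostate_iff.2 hp⟩

theorem IsCostate.eqOn {q : ℝ → EuclideanSpace ℝ (Fin n)} (hU : IsCompact P.U)
    (h : P.LipschitzC1With L) (hz : z ∈ P.feasible) (hp : P.IsCostate z p)
    (hq : P.IsCostate z q) : EqOn p q (Icc 0 P.T) :=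
  IsPrimitiveTo.eqOn (isCaratheodoryField_costate hU h hz).lipschitzWith (isCostate_iff.1 hp)
    (isCostate_iff.1 hq)

theorem exists_variation (hT : 0 ≤ P.T) (hU : IsCompact P.U) (h : P.LipschitzC1With L)
    (hz : z ∈ P.feasible) {δu : ℝ → EuclideanSpace ℝ (Fin m)}
    (hδu : Integrable δu P.timeMeasure) :
    ∃ δx, MemLp δx 2 P.timeMeasure ∧ P.SolvesFrom δx
      (fun t => P.fx t (z.1 t) (z.2 t) (δx t) + P.fu t (z.1 t) (z.2 t) (δu t)) 0 := by
  obtain ⟨δx, hδx⟩ := (IsCaratheodoryField.of_clm (memLp_top_fx hU h hz).1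
    (ae_norm_fx_le h hz)
    (integrable_clm_apply_of_memLp_top (memLp_top_fu hU h hz) hδu)).exists_isPrimitiveFrom hT 0
  exact ⟨δx, (memLp_top_of_continuousOn hδx.continuousOn).mono_exponent le_top, hδx⟩

-- Integration by parts: the costate equation is the adjoint of the linearized state equation.
theorem IsCostate.inner_gradient_eq (hT : 0 ≤ P.T) (hp : P.IsCostate z p)
    {d g : ℝ → EuclideanSpace ℝ (Fin n)} (hd : P.SolvesFrom d g 0) :
    inner ℝ (gradient P.Ψ (z.1 P.T)) (d P.T) =
      ∫ t, inner ℝ (p t) (g t - P.fx t (z.1 t) (z.2 t) (d t)) ∂P.timeMeasure := by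
  have hparts := (isCostate_iff.1 hp).isPrimitiveFrom.integral_inner_deriv_add_inner_deriv hT
    (solvesFrom_iff.1 hd)
  rw [(isCostate_iff.1 hp).apply_end hT, inner_zero_right, sub_zero] at hparts
  rw [← hparts, ← intervalIntegral_eq_integral_timeMeasure hT]
  congr with t
  rw [Pi.neg_apply, inner_neg_left, ContinuousLinearMap.adjoint_inner_left, inner_sub_right]
  ring

end Trajectories

section Increments

/-- The integrated Hamiltonian difference between the inputs `u` and `z.2`, along the state `z.1`
and with the costate `p`: the objective of the problem that defines `θ_{o,h}`. -/
noncomputable def hamIncrement (P : ControlProblem n m)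
    (z : (ℝ → EuclideanSpace ℝ (Fin n)) × (ℝ → EuclideanSpace ℝ (Fin m)))
    (p : ℝ → EuclideanSpace ℝ (Fin n)) (u : ℝ → EuclideanSpace ℝ (Fin m)) : ℝ :=
  ∫ t in (0 : ℝ)..P.T,
    (P.hamiltonian t (z.1 t) (u t) (p t) - P.hamiltonian t (z.1 t) (z.2 t) (p t))

/-- The part of `hamIncrement` that is linear in `u - z.2`: the objective of the linearized problem
at `z` in terms of the costate `p`, see `mem_linValues_iff`. -/
noncomputable def linIncrement (P : ControlProblem n m)
    (z : (ℝ → EuclideanSpace ℝ (Fin n)) × (ℝ → EuclideanSpace ℝ (Fin m)))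
    (p : ℝ → EuclideanSpace ℝ (Fin n)) (u : ℝ → EuclideanSpace ℝ (Fin m)) : ℝ :=
  ∫ t in (0 : ℝ)..P.T, inner ℝ (p t) (P.fu t (z.1 t) (z.2 t) (u t - z.2 t))

/-- The `L¹` distance between two inputs. -/
noncomputable def inputDist (P : ControlProblem n m) (u v : ℝ → EuclideanSpace ℝ (Fin m)) : ℝ :=
  ∫ t, ‖u t - v t‖ ∂P.timeMeasure

theorem inputDist_nonneg : 0 ≤ P.inputDist u v :=
  integral_nonneg fun _ => norm_nonneg _

theorem integrable_hamiltonian (hU : IsCompact P.U) (h : P.LipschitzC1With L)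
    (hz : z ∈ P.feasible) (hp : P.IsCostate z p) (hu : P.IsInput u) :
    Integrable (fun t => P.hamiltonian t (z.1 t) (u t) (p t)) P.timeMeasure :=
  integrable_inner_of_memLp_top (memLp_top_of_continuousOn hp.continuousOn)
    ((memLp_top_along hU h.continuousOn_f (continuousOn_of_mem_feasible hz) hu).integrable le_top)

theorem integrable_hamiltonian_sub (hU : IsCompact P.U) (h : P.LipschitzC1With L)
    (hz : z ∈ P.feasible) (hp : P.IsCostate z p) (hu : P.IsInput u) :
    Integrable (fun t => P.hamiltonian t (z.1 t) (u t) (p t) -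
      P.hamiltonian t (z.1 t) (z.2 t) (p t)) P.timeMeasure :=
  (integrable_hamiltonian hU h hz hp hu).sub (integrable_hamiltonian hU h hz hp hz.2.1)

theorem integrable_inner_fu (hU : IsCompact P.U) (h : P.LipschitzC1With L)
    (hz : z ∈ P.feasible) (hp : P.IsCostate z p) (hu : P.IsInput u) :
    Integrable (fun t => inner ℝ (p t) (P.fu t (z.1 t) (z.2 t) (u t - z.2 t))) P.timeMeasure :=
  integrable_inner_of_memLp_top (memLp_top_of_continuousOn hp.continuousOn)
    (integrable_clm_apply_of_memLp_top (memLp_top_fu hU h hz)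
      (hu.integrable.sub hz.2.1.integrable))

theorem mem_linValues_iff (hT : 0 ≤ P.T) (hU : IsCompact P.U) (h : P.LipschitzC1With L)
    (hz : z ∈ P.feasible) (hp : P.IsCostate z p) {r : ℝ} :
    r ∈ P.linValues z ↔ ∃ u, P.IsInput u ∧ r = P.linIncrement z p u := by
  constructor
  · rintro ⟨δx, δu, -, hδu, hδx, hδuU, rfl⟩
    refine ⟨fun t => z.2 t + δu t, ⟨hz.2.1.1.add hδu, hδuU⟩, ?_⟩
    simp [hp.inner_gradient_eq hT hδx, linIncrement, intervalIntegral_eq_integral_timeMeasure hT]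
  · rintro ⟨u, hu, rfl⟩
    have hδu : MemLp (fun t => u t - z.2 t) 2 P.timeMeasure := hu.1.sub hz.2.1.1
    obtain ⟨δx, hδx_mem, hδx⟩ := exists_variation hT hU h hz (hδu.integrable one_le_two)
    refine ⟨δx, fun t => u t - z.2 t, hδx_mem, hδu, hδx, by simpa using hu.2, ?_⟩
    simp [hp.inner_gradient_eq hT hδx, linIncrement, intervalIntegral_eq_integral_timeMeasure hT]

end Increments

/-! ### Attainment of the minima -/

section Minima

theorem exists_isInput_argmin {Y : Type*} [TopologicalSpace Y] [MeasurableSpace Y]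
    [OpensMeasurableSpace Y] (hU : IsCompact P.U) (hne : P.U.Nonempty)
    {φ : Y → EuclideanSpace ℝ (Fin m) → ℝ} (hφ : ContinuousOn (Function.uncurry φ) (univ ×ˢ P.U))
    {c : ℝ → Y} (hc : AEMeasurable c P.timeMeasure) :
    ∃ u, P.IsInput u ∧ ∀ t, ∀ v ∈ P.U, φ (c t) (u t) ≤ φ (c t) v := by
  obtain ⟨s, hs, hmin⟩ := exists_measurable_argmin hU hne hφ
  exact ⟨fun t => s (c t), isInput_of_aestronglyMeasurable hU
    (hs.comp_aemeasurable hc).aestronglyMeasurable (Filter.Eventually.of_forall fun t =>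
    (hmin (c t)).1), fun t => (hmin (c t)).2⟩

theorem exists_isInput_forall_hamIncrement_le (hT : 0 ≤ P.T) (hU : IsCompact P.U)
    (hne : P.U.Nonempty) (h : P.LipschitzC1With L) (hz : z ∈ P.feasible)
    (hp : P.IsCostate z p) :
    ∃ u, P.IsInput u ∧ ∀ v, P.IsInput v → P.hamIncrement z p u ≤ P.hamIncrement z p v := by
  have hham : ContinuousOn (fun q : Icc 0 P.T × EuclideanSpace ℝ (Fin m) =>
      P.hamiltonian q.1 (z.1 q.1) q.2 (p q.1)) (univ ×ˢ P.U) := by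
    have hval : Continuous fun q : Icc 0 P.T × EuclideanSpace ℝ (Fin m) => (q.1 : ℝ) := by fun_prop
    exact (hp.continuousOn.comp hval.continuousOn fun q _ => q.1.2).inner
      ((continuousOn_along h.continuousOn_f (continuousOn_of_mem_feasible hz)).comp
        (hval.prodMk continuous_snd).continuousOn fun q hq => ⟨q.1.2, hq.2⟩)
  obtain ⟨u, hu, hmin⟩ := exists_isInput_argmin hU hne
    (φ := fun (τ : Icc 0 P.T) v => P.hamiltonian τ (z.1 τ) v (p τ)) hham
    (continuous_projIcc (h := hT)).measurable.aemeasurable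
  refine ⟨u, hu, fun v hv => ?_⟩
  simp only [hamIncrement, intervalIntegral_eq_integral_timeMeasure hT]
  refine integral_mono_ae (integrable_hamiltonian_sub hU h hz hp hu)
    (integrable_hamiltonian_sub hU h hz hp hv) ?_
  filter_upwards [ae_mem_Icc, hv.2] with t ht hvt
  simpa [projIcc_of_mem hT ht] using hmin t (v t) hvt

theorem exists_isInput_forall_linIncrement_le (hT : 0 ≤ P.T) (hU : IsCompact P.U)
    (hne : P.U.Nonempty) (h : P.LipschitzC1With L) (hz : z ∈ P.feasible)
    (hp : P.IsCostate z p) :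
    ∃ u, P.IsInput u ∧ ∀ v, P.IsInput v → P.linIncrement z p u ≤ P.linIncrement z p v := by
  have hfu : AEStronglyMeasurable (fun t => (P.fu t (z.1 t) (z.2 t)).adjoint) P.timeMeasure :=
    ContinuousLinearMap.adjoint.continuous.comp_aestronglyMeasurable (memLp_top_fu hU h hz).1
  have hadj : AEStronglyMeasurable (fun t => (P.fu t (z.1 t) (z.2 t)).adjoint (p t))
      P.timeMeasure :=
    isBoundedBilinearMap_apply.continuous.comp_aestronglyMeasurable
      (hfu.prodMk (memLp_top_of_continuousOn hp.continuousOn).1)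
  obtain ⟨u, hu, hmin⟩ := exists_isInput_argmin hU hne
    (φ := fun (q v : EuclideanSpace ℝ (Fin m)) => inner ℝ q v) (by fun_prop) hadj.aemeasurable
  refine ⟨u, hu, fun v hv => ?_⟩
  simp only [linIncrement, intervalIntegral_eq_integral_timeMeasure hT]
  refine integral_mono_ae (integrable_inner_fu hU h hz hp hu)
    (integrable_inner_fu hU h hz hp hv) ?_
  filter_upwards [hv.2] with t hvt
  have hle := hmin t (v t) hvt
  simp only [ContinuousLinearMap.adjoint_inner_left] at hle
  simpa only [map_sub, inner_sub_right, sub_le_sub_iff_right] using hle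

theorem isLeast_thetaH (hT : 0 ≤ P.T) (hU : IsCompact P.U) (hne : P.U.Nonempty)
    (h : P.LipschitzC1With L) (hz : z ∈ P.feasible) : IsLeast (P.hamValues z) (P.thetaH z) := by
  obtain ⟨u, hu, hmin⟩ := exists_isInput_forall_hamIncrement_le hT hU hne h hz
    (isCostate_costate hT hU h hz)
  have hleast : IsLeast (P.hamValues z) (P.hamIncrement z (P.costate z) u) :=
    ⟨⟨u, hu, rfl⟩, by rintro _ ⟨v, hv, rfl⟩; exact hmin v hv⟩
  rwa [thetaH, hleast.csInf_eq]

theorem isLeast_thetaL (hT : 0 ≤ P.T) (hU : IsCompact P.U) (hne : P.U.Nonempty)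
    (h : P.LipschitzC1With L) (hz : z ∈ P.feasible) : IsLeast (P.linValues z) (P.thetaL z) := by
  have hp := isCostate_costate hT hU h hz
  obtain ⟨u, hu, hmin⟩ := exists_isInput_forall_linIncrement_le hT hU hne h hz hp
  have hleast : IsLeast (P.linValues z) (P.linIncrement z (P.costate z) u) := by
    refine ⟨(mem_linValues_iff hT hU h hz hp).2 ⟨u, hu, rfl⟩, fun r hr => ?_⟩
    obtain ⟨v, hv, rfl⟩ := (mem_linValues_iff hT hU h hz hp).1 hr
    exact hmin v hv
  rwa [thetaL, hleast.csInf_eq]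

theorem zero_mem_hamValues (hz : z ∈ P.feasible) : 0 ∈ P.hamValues z :=
  ⟨z.2, hz.2.1, by simp⟩

theorem zero_mem_linValues (hT : 0 ≤ P.T) (hU : IsCompact P.U) (h : P.LipschitzC1With L)
    (hz : z ∈ P.feasible) : 0 ∈ P.linValues z :=
  (mem_linValues_iff hT hU h hz (isCostate_costate hT hU h hz)).2
    ⟨z.2, hz.2.1, by simp [linIncrement]⟩

end Minima

/-! ### First-order optimality -/

section Perturbation

theorem norm_state_sub_le (hT : 0 ≤ P.T) (h : P.LipschitzC1With L) (hz : z ∈ P.feasible)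
    (hw : w ∈ P.feasible) :
    ∀ t ∈ Icc 0 P.T,
      ‖w.1 t - z.1 t‖ ≤ L * Real.exp (L * P.T) * P.inputDist w.2 z.2 := by
  intro t ht
  have hinput : Integrable (fun t => ‖w.2 t - z.2 t‖) P.timeMeasure :=
    (hw.2.1.integrable.sub hz.2.1.integrable).norm
  have hgrowth : ∀ᵐ t ∂P.timeMeasure, ‖P.f t (w.1 t) (w.2 t) - P.f t (z.1 t) (z.2 t)‖ ≤
      L * ‖w.2 t - z.2 t‖ + L * ‖w.1 t - z.1 t‖ := by
    filter_upwards [ae_mem_Icc, hw.2.1.2, hz.2.1.2] with t ht hwt hzt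
    refine (h.lip_f t ht t ht _ _ _ hwt _ hzt).trans_eq ?_
    rw [sub_self, abs_zero]
    ring
  have hgronwall := ((solvesFrom_iff.1 hw.2.2).sub (solvesFrom_iff.1 hz.2.2)).norm_le
    (hinput.const_mul (L : ℝ)) (fun t => by positivity) hgrowth t ht
  rw [sub_self, norm_zero, zero_add, intervalIntegral_eq_integral_timeMeasure hT,
    integral_const_mul] at hgronwall
  calc ‖w.1 t - z.1 t‖ ≤ L * P.inputDist w.2 z.2 * Real.exp (L * t) := hgronwall
    _ ≤ L * P.inputDist w.2 z.2 * Real.exp (L * P.T) := by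
        have := inputDist_nonneg (P := P) (u := w.2) (v := z.2)
        gcongr
        exact ht.2
    _ = L * Real.exp (L * P.T) * P.inputDist w.2 z.2 := by ring

/-- The remainder of the linearization in the state of the vector field, from the state of `z` to
that of `w`. The field is evaluated at the input of `w` but its derivative at that of `z`, as
in the costate equation of `z`. -/
noncomputable def stateRemainder (P : ControlProblem n m)
    (z w : (ℝ → EuclideanSpace ℝ (Fin n)) × (ℝ → EuclideanSpace ℝ (Fin m))) (t : ℝ) :
    EuclideanSpace ℝ (Fin n) :=
  P.f t (w.1 t) (w.2 t) - P.f t (z.1 t) (w.2 t) - P.fx t (z.1 t) (z.2 t) (w.1 t - z.1 t)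

theorem integrable_stateRemainder (hU : IsCompact P.U) (h : P.LipschitzC1With L)
    (hz : z ∈ P.feasible) (hw : w ∈ P.feasible) :
    Integrable (P.stateRemainder z w) P.timeMeasure := by
  have hfield : ∀ {x}, ContinuousOn x (Icc 0 P.T) →
      Integrable (fun t => P.f t (x t) (w.2 t)) P.timeMeasure := fun hx =>
    (memLp_top_along hU h.continuousOn_f hx hw.2.1).integrable le_top
  have hdiff : Integrable (fun t => w.1 t - z.1 t) P.timeMeasure :=
    (memLp_top_of_continuousOn ((continuousOn_of_mem_feasible hw).sub
      (continuousOn_of_mem_feasible hz))).integrable le_top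
  exact ((hfield (continuousOn_of_mem_feasible hw)).sub
    (hfield (continuousOn_of_mem_feasible hz))).sub
    (integrable_clm_apply_of_memLp_top (memLp_top_fx hU h hz) hdiff)

theorem inner_gradient_state_sub_eq (hT : 0 ≤ P.T) (hU : IsCompact P.U)
    (h : P.LipschitzC1With L) (hz : z ∈ P.feasible) (hp : P.IsCostate z p)
    (hw : w ∈ P.feasible) :
    inner ℝ (gradient P.Ψ (z.1 P.T)) (w.1 P.T - z.1 P.T) =
      P.hamIncrement z p w.2 + ∫ t, inner ℝ (p t) (P.stateRemainder z w t) ∂P.timeMeasure := by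
  have hdiff : P.SolvesFrom (w.1 - z.1)
      ((fun t => P.f t (w.1 t) (w.2 t)) - fun t => P.f t (z.1 t) (z.2 t)) 0 := by
    simpa using solvesFrom_iff.2 ((solvesFrom_iff.1 hw.2.2).sub (solvesFrom_iff.1 hz.2.2))
  rw [← Pi.sub_apply, hp.inner_gradient_eq hT hdiff, hamIncrement,
    intervalIntegral_eq_integral_timeMeasure hT,
    ← integral_add (integrable_hamiltonian_sub hU h hz hp hw.2.1)
      (integrable_inner_of_memLp_top (memLp_top_of_continuousOn hp.continuousOn)
        (integrable_stateRemainder hU h hz hw))]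
  congr with t
  simp only [hamiltonian, stateRemainder, Pi.sub_apply, inner_sub_right]
  ring

theorem integral_inner_stateRemainder_le (hT : 0 ≤ P.T) (h : P.LipschitzC1With L)
    (hz : z ∈ P.feasible) (hw : w ∈ P.feasible) {M S : ℝ} (hM : 0 ≤ M)
    (hp : ∀ t ∈ Icc 0 P.T, ‖p t‖ ≤ M) (hS : ∀ t ∈ Icc 0 P.T, ‖w.1 t - z.1 t‖ ≤ S) :
    ∫ t, inner ℝ (p t) (P.stateRemainder z w t) ∂P.timeMeasure ≤
      M * (L * S ^ 2 * P.T + L * S * P.inputDist w.2 z.2) := by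
  have hinput : Integrable (fun t => ‖w.2 t - z.2 t‖) P.timeMeasure :=
    (hw.2.1.integrable.sub hz.2.1.integrable).norm
  have : 0 ≤ S := (norm_nonneg _).trans (hS 0 ⟨le_rfl, hT⟩)
  have hbound : ∀ᵐ t ∂P.timeMeasure, ‖inner ℝ (p t) (P.stateRemainder z w t)‖ ≤
      M * (L * S ^ 2 + L * S * ‖w.2 t - z.2 t‖) := by
    filter_upwards [ae_mem_Icc, hw.2.1.2, hz.2.1.2] with t ht hwt hzt
    calc _ ≤ ‖p t‖ * ‖P.stateRemainder z w t‖ := norm_inner_le_norm _ _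
      _ ≤ M * (L * S ^ 2 + L * ‖w.2 t - z.2 t‖ * S) := by
          gcongr
          · exact hp t ht
          · refine (h.norm_f_sub_sub_fx_le ht hzt hwt).trans ?_
            gcongr <;> exact hS t ht
      _ = _ := by ring
  refine (Real.le_norm_self _).trans ((norm_integral_le_of_norm_le
    (((integrable_const _).add (hinput.const_mul _)).const_mul M) hbound).trans_eq ?_)
  rw [integral_const_mul, integral_add' (integrable_const _) (hinput.const_mul _),
    integral_const, integral_const_mul, timeMeasure_real_univ hT, inputDist, smul_eq_mul]
  ring

theorem exists_cost_sub_le (hT : 0 ≤ P.T) (hU : IsCompact P.U) (h : P.LipschitzC1With L)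
    (hz : z ∈ P.feasible) (hp : P.IsCostate z p) :
    ∃ C, 0 ≤ C ∧ ∀ w ∈ P.feasible,
      P.cost w - P.cost z ≤ P.hamIncrement z p w.2 + C * P.inputDist w.2 z.2 ^ 2 := by
  obtain ⟨M, hM⟩ := isCompact_Icc.exists_bound_of_continuousOn hp.continuousOn
  have hM0 : 0 ≤ M := (norm_nonneg _).trans (hM 0 ⟨le_rfl, hT⟩)
  let E := L * Real.exp (L * P.T)
  refine ⟨L * E ^ 2 + M * (L * E ^ 2 * P.T + L * E), by positivity, fun w hw => ?_⟩
  set δ := P.inputDist w.2 z.2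
  have hstate : ∀ t ∈ Icc 0 P.T, ‖w.1 t - z.1 t‖ ≤ E * δ := norm_state_sub_le hT h hz hw
  calc P.cost w - P.cost z
      ≤ inner ℝ (gradient P.Ψ (z.1 P.T)) (w.1 P.T - z.1 P.T) + L * ‖w.1 P.T - z.1 P.T‖ ^ 2 :=
        h.Ψ_sub_le _ _
    _ ≤ P.hamIncrement z p w.2 + M * (L * (E * δ) ^ 2 * P.T + L * (E * δ) * δ) +
          L * (E * δ) ^ 2 := by
        rw [inner_gradient_state_sub_eq hT hU h hz hp hw]
        gcongr
        · exact integral_inner_stateRemainder_le hT h hz hw hM0 hM hstate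
        · exact hstate P.T ⟨hT, le_rfl⟩
    _ = _ := by ring

theorem nonneg_of_forall_hamIncrement_le (hT : 0 ≤ P.T) (hU : IsCompact P.U)
    (h : P.LipschitzC1With L) (hz : z ∈ P.feasible) (hmin : IsMinOn P.cost P.feasible z)
    (hp : P.IsCostate z p) {r K D : ℝ}
    (hvar : ∀ N : ℕ, 0 < N → ∃ u, P.IsInput u ∧
      P.hamIncrement z p u ≤ r / N + K / (N : ℝ) ^ 2 ∧ P.inputDist u z.2 ≤ D / N) :
    0 ≤ r := by
  obtain ⟨C, hC, hcost⟩ := exists_cost_sub_le hT hU h hz hp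
  refine nonneg_of_forall_nonneg_div_add_div_sq (K := K + C * D ^ 2) fun N hN => ?_
  obtain ⟨u, hu, hham, hdist⟩ := hvar N hN
  obtain ⟨x, hx⟩ := exists_mem_feasible hT hU h hu
  calc 0 ≤ P.cost (x, u) - P.cost z := sub_nonneg.2 (hmin hx)
    _ ≤ P.hamIncrement z p u + C * P.inputDist u z.2 ^ 2 := hcost _ hx
    _ ≤ r / N + K / (N : ℝ) ^ 2 + C * (D / N) ^ 2 := by
        have := inputDist_nonneg (P := P) (u := u) (v := z.2)
        gcongr
    _ = r / N + (K + C * D ^ 2) / (N : ℝ) ^ 2 := by ring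

end Perturbation

theorem ae_norm_input_sub_le_diam (hU : IsCompact P.U) (hu : P.IsInput u) (hv : P.IsInput v) :
    ∀ᵐ t ∂P.timeMeasure, ‖u t - v t‖ ≤ Metric.diam P.U := by
  filter_upwards [hu.2, hv.2] with t hut hvt
  exact dist_eq_norm (u t) (v t) ▸ Metric.dist_le_diam_of_mem hU.isBounded hut hvt

section Needle

open scoped Classical in
/-- The input that follows `u` on the time interval `(a, b]` and `v` elsewhere. -/
noncomputable def needle (a b : ℝ) (u v : ℝ → EuclideanSpace ℝ (Fin m)) :
    ℝ → EuclideanSpace ℝ (Fin m) :=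
  (Ioc a b).piecewise u v

variable {a b : ℝ}

theorem isInput_needle (hu : P.IsInput u) (hv : P.IsInput v) : P.IsInput (needle a b u v) := by
  refine ⟨hu.1.restrict _ |>.piecewise measurableSet_Ioc (hv.1.restrict _), ?_⟩
  filter_upwards [hu.2, hv.2] with t hut hvt
  rw [needle, piecewise]
  split_ifs
  exacts [hut, hvt]

theorem integral_needle {φ : ℝ → EuclideanSpace ℝ (Fin m) → ℝ} (ha : 0 ≤ a) (hab : a ≤ b)
    (hb : b ≤ P.T) (hφ : ∀ t, φ t (v t) = 0) :
    ∫ t, φ t (needle a b u v t) ∂P.timeMeasure = ∫ t in a..b, φ t (u t) := by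
  have hsub : Ioc a b ⊆ Icc 0 P.T := fun t ht => ⟨ha.trans ht.1.le, ht.2.trans hb⟩
  have hind : (fun t => φ t (needle a b u v t)) = (Ioc a b).indicator fun t => φ t (u t) := by
    ext t
    by_cases ht : t ∈ Ioc a b <;> simp [needle, ht, hφ]
  rw [hind, integral_indicator measurableSet_Ioc, timeMeasure,
    Measure.restrict_restrict measurableSet_Ioc, inter_eq_left.2 hsub,
    intervalIntegral.integral_of_le hab]

theorem inputDist_needle_le (hU : IsCompact P.U) (hu : P.IsInput u) (hv : P.IsInput v)
    (ha : 0 ≤ a) (hab : a ≤ b) (hb : b ≤ P.T) :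
    P.inputDist (needle a b u v) v ≤ Metric.diam P.U * (b - a) := by
  have hsub : Ioc a b ⊆ Icc 0 P.T := fun t ht => ⟨ha.trans ht.1.le, ht.2.trans hb⟩
  have hdiam : ∀ᵐ t, t ∈ Ioc a b → ‖u t - v t‖ ≤ Metric.diam P.U := by
    filter_upwards [(ae_restrict_iff' measurableSet_Icc).1 (ae_norm_input_sub_le_diam hU hu hv)]
      with t hdist ht using hdist (hsub ht)
  rw [inputDist, integral_needle (φ := fun t c => ‖c - v t‖) ha hab hb (by simp)]
  calc ∫ t in a..b, ‖u t - v t‖ ≤ ‖∫ t in a..b, ‖u t - v t‖‖ := Real.le_norm_self _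
    _ ≤ Metric.diam P.U * |b - a| := intervalIntegral.norm_integral_le_of_norm_le_const_ae (by
        simpa only [norm_norm, uIoc_of_le hab] using hdiam)
    _ = Metric.diam P.U * (b - a) := by rw [abs_of_nonneg (sub_nonneg.2 hab)]

theorem hamIncrement_nonneg_of_isMinOn (hT : 0 ≤ P.T) (hU : IsCompact P.U)
    (h : P.LipschitzC1With L) (hz : z ∈ P.feasible) (hmin : IsMinOn P.cost P.feasible z)
    (hp : P.IsCostate z p) (hu : P.IsInput u) : 0 ≤ P.hamIncrement z p u := by
  refine nonneg_of_forall_hamIncrement_le hT hU h hz hmin hp (K := 0)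
    (D := Metric.diam P.U * P.T) fun N hN => ?_
  obtain ⟨a, ha, b, hb, hlen, hle⟩ :=
    exists_intervalIntegral_le_div hT (integrable_hamiltonian_sub hU h hz hp hu) hN
  refine ⟨needle a b u z.2, isInput_needle hu hz.2.1, ?_, ?_⟩
  · rw [hamIncrement, intervalIntegral_eq_integral_timeMeasure hT, integral_needle
      (φ := fun t c => P.hamiltonian t (z.1 t) c (p t) - P.hamiltonian t (z.1 t) (z.2 t) (p t))
      ha.1 hb.1 hb.2 (by simp)]
    simpa [hamIncrement] using hle
  · rw [mul_div_assoc, ← hlen]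
    exact inputDist_needle_le hU hu hz.2.1 ha.1 hb.1 hb.2

end Needle

section Convex

variable {s : ℝ}

theorem isInput_add_smul_sub (hconv : Convex ℝ P.U) (hs : s ∈ Icc (0 : ℝ) 1) (hu : P.IsInput u)
    (hv : P.IsInput v) : P.IsInput (v + s • (u - v)) := by
  refine ⟨hv.1.add ((hu.1.sub hv.1).const_smul s), ?_⟩
  filter_upwards [hu.2, hv.2] with t hut hvt using hconv.add_smul_sub_mem hvt hut hs

theorem inputDist_add_smul_sub_le (hT : 0 ≤ P.T) (hU : IsCompact P.U) (hs : 0 ≤ s)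
    (hu : P.IsInput u) (hv : P.IsInput v) :
    P.inputDist (v + s • (u - v)) v ≤ s * (Metric.diam P.U * P.T) := by
  have hdist : ∫ t, ‖u t - v t‖ ∂P.timeMeasure ≤ Metric.diam P.U * P.T := by
    simpa [timeMeasure_real_univ hT, mul_comm] using integral_mono_ae
      (hu.integrable.sub hv.integrable).norm (integrable_const _)
      (ae_norm_input_sub_le_diam hU hu hv)
  simpa [inputDist, norm_smul, integral_const_mul, abs_of_nonneg hs] using
    mul_le_mul_of_nonneg_left hdist hs

theorem hamIncrement_add_smul_sub_le (hT : 0 ≤ P.T) (hU : IsCompact P.U)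
    (hconv : Convex ℝ P.U) (h : P.LipschitzC1With L) (hz : z ∈ P.feasible)
    (hp : P.IsCostate z p) (hu : P.IsInput u) {M : ℝ} (hM : ∀ t ∈ Icc 0 P.T, ‖p t‖ ≤ M)
    (hs : s ∈ Icc (0 : ℝ) 1) :
    P.hamIncrement z p (z.2 + s • (u - z.2)) ≤
      s * P.linIncrement z p u + s ^ 2 * (M * L * Metric.diam P.U ^ 2 * P.T) := by
  have hlin : Integrable (fun t => s * inner ℝ (p t) (P.fu t (z.1 t) (z.2 t) (u t - z.2 t)))
      P.timeMeasure := (integrable_inner_fu hU h hz hp hu).const_mul s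
  have hpoint : ∀ᵐ t ∂P.timeMeasure,
      P.hamiltonian t (z.1 t) ((z.2 + s • (u - z.2)) t) (p t) -
          P.hamiltonian t (z.1 t) (z.2 t) (p t) ≤
        s * inner ℝ (p t) (P.fu t (z.1 t) (z.2 t) (u t - z.2 t)) +
          s ^ 2 * (M * L * Metric.diam P.U ^ 2) := by
    filter_upwards [ae_mem_Icc, hz.2.1.2, (isInput_add_smul_sub hconv hs hu hz.2.1).2,
      ae_norm_input_sub_le_diam hU hu hz.2.1] with t ht hzt hvt hdiam
    have hM0 : 0 ≤ M := (norm_nonneg _).trans (hM t ht)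
    have htaylor := h.hamiltonian_sub_le hconv ht (a := z.1 t) (b := p t) hzt hvt
    simp only [Pi.add_apply, Pi.smul_apply, Pi.sub_apply, add_sub_cancel_left, map_smul,
      inner_smul_right, norm_smul, Real.norm_of_nonneg hs.1] at htaylor ⊢
    refine htaylor.trans (add_le_add_right ?_ _)
    calc ‖p t‖ * (L * (s * ‖u t - z.2 t‖) ^ 2) ≤ M * (L * (s * Metric.diam P.U) ^ 2) := by
          have := hs.1
          gcongr
          exact hM t ht
      _ = s ^ 2 * (M * L * Metric.diam P.U ^ 2) := by ring
  simp only [hamIncrement, linIncrement, intervalIntegral_eq_integral_timeMeasure hT]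
  refine (integral_mono_ae (integrable_hamiltonian_sub hU h hz hp
    (isInput_add_smul_sub hconv hs hu hz.2.1)) (hlin.add (integrable_const _)) hpoint).trans_eq ?_
  rw [integral_add' hlin (integrable_const _), integral_const_mul, integral_const,
    timeMeasure_real_univ hT, smul_eq_mul]
  ring

theorem linIncrement_nonneg_of_isMinOn (hT : 0 ≤ P.T) (hU : IsCompact P.U)
    (hconv : Convex ℝ P.U) (h : P.LipschitzC1With L) (hz : z ∈ P.feasible)
    (hmin : IsMinOn P.cost P.feasible z) (hp : P.IsCostate z p) (hu : P.IsInput u) :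
    0 ≤ P.linIncrement z p u := by
  obtain ⟨M, hM⟩ := isCompact_Icc.exists_bound_of_continuousOn hp.continuousOn
  refine nonneg_of_forall_hamIncrement_le hT hU h hz hmin hp
    (K := M * L * Metric.diam P.U ^ 2 * P.T) (D := Metric.diam P.U * P.T) fun N hN => ?_
  have hs : (N : ℝ)⁻¹ ∈ Icc (0 : ℝ) 1 :=
    ⟨by positivity, inv_le_one_of_one_le₀ (Nat.one_le_cast.2 hN)⟩
  refine ⟨z.2 + (N : ℝ)⁻¹ • (u - z.2), isInput_add_smul_sub hconv hs hu hz.2.1, ?_, ?_⟩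
  · refine (hamIncrement_add_smul_sub_le hT hU hconv h hz hp hu hM hs).trans_eq ?_
    ring
  · exact (inputDist_add_smul_sub_le hT hU hs.1 hu hz.2.1).trans_eq (inv_mul_eq_div _ _)

end Convex

theorem U_nonempty_of_mem_feasible (hT : 0 < P.T) (hz : z ∈ P.feasible) : P.U.Nonempty := by
  have : (ae P.timeMeasure).NeBot := by
    rw [ae_neBot, timeMeasure, Ne, Measure.restrict_eq_zero]
    simp [hT]
  exact hz.2.1.2.exists.imp' z.2 fun _ => id

end ControlProblem

open ControlProblem in
theorem mainTheorem10_general (n m : ℕ) (P : ControlProblem n m) (hT : 0 < P.T)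
    (hU : IsCompact P.U) {L : ℝ≥0} (h : P.LipschitzC1With L) :
    ((∀ z ∈ P.feasible, IsLeast (P.linValues z) (P.thetaL z)) ∧
      (∀ z ∈ P.feasible, P.thetaL z ≤ 0) ∧
      (Convex ℝ P.U → IsOptimalityFunction P.feasible P.cost P.thetaL)) ∧
    ((∀ z ∈ P.feasible, P.IsCostate z (P.costate z) ∧
        (∀ p, P.IsCostate z p → EqOn p (P.costate z) (Icc 0 P.T)) ∧
        IsLeast (P.hamValues z) (P.thetaH z)) ∧
      IsOptimalityFunction P.feasible P.cost P.thetaH) := by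
  have hcostate z (hz : z ∈ P.feasible) := isCostate_costate hT.le hU h hz
  have hlin z (hz : z ∈ P.feasible) :=
    isLeast_thetaL hT.le hU (U_nonempty_of_mem_feasible hT hz) h hz
  have hham z (hz : z ∈ P.feasible) :=
    isLeast_thetaH hT.le hU (U_nonempty_of_mem_feasible hT hz) h hz
  have hzero z (hz : z ∈ P.feasible) := zero_mem_linValues hT.le hU h hz
  refine ⟨⟨hlin, fun z hz => (hlin z hz).2 (hzero z hz), fun hconv =>
    isOptimalityFunction_of_isLeast hlin hzero fun z hz hmin r hr => ?_⟩,
    fun z hz => ⟨hcostate z hz, fun p hp => hp.eqOn hU h hz (hcostate z hz), hham z hz⟩,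
    isOptimalityFunction_of_isLeast hham (fun z => zero_mem_hamValues) fun z hz hmin r hr => ?_⟩
  · obtain ⟨u, hu, rfl⟩ := (mem_linValues_iff hT.le hU h hz (hcostate z hz)).1 hr
    exact linIncrement_nonneg_of_isMinOn hT.le hU hconv h hz hmin (hcostate z hz) hu
  · obtain ⟨u, hu, rfl⟩ := hr
    exact hamIncrement_nonneg_of_isMinOn hT.le hU h hz hmin (hcostate z hz) hu

theorem mainTheorem10 (n m : ℕ) (P : ControlProblem n m) (hT : 0 < P.T)
    (hUconn : IsConnected P.U) (hUcomp : IsCompact P.U)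
    (hLip : ∃ L : ℝ, 0 < L ∧ P.LipschitzC1With L) :
    -- the minimum defining `θ_{o,l}` is attained, so that `θ_{o,l}` is well defined
    ((∀ z ∈ P.feasible, IsLeast (P.linValues z) (P.thetaL z)) ∧
      -- `θ_{o,l}` is an optimality function, for convex `U`
      (∀ z ∈ P.feasible, P.thetaL z ≤ 0) ∧
      (Convex ℝ P.U → IsOptimalityFunction P.feasible P.cost P.thetaL)) ∧
    -- the costate exists and is unique, and the minimum defining `θ_{o,h}` is attained
    ((∀ z ∈ P.feasible, P.IsCostate z (P.costate z) ∧
        (∀ p, P.IsCostate z p → Set.EqOn p (P.costate z) (Set.Icc 0 P.T)) ∧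
        IsLeast (P.hamValues z) (P.thetaH z)) ∧
      -- `θ_{o,h}` is an optimality function
      IsOptimalityFunction P.feasible P.cost P.thetaH) := by
  obtain ⟨L, hL, h⟩ := hLip
  exact mainTheorem10_general n m P hT hUcomp (L := ⟨L, hL.le⟩) h
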